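/- Let $(M,g,J,\omega)$ be an almost Hermitian $4$-manifold: $M$ is a smooth $4$-manifold, $g$ a smooth Riemannian metric, $J$ a smooth $g$-orthogonal almost complex structure, $\omega(X,Y)=g(JX,Y)$. Let $\nabla$ be the Levi-Civita connection, $R_{X,Y}=\nabla_{[X,Y]}-[\nabla_X,\nabla_Y]$, $R_{XYZW}=g(R_{X,Y}Z,W)$, let $\mathrm{Ric}$ be the Ricci tensor (positive on round spheres), $s$ its trace, $\mathrm{Ric}_0=\mathrm{Ric}-\frac s4 g$, viewed also as an endomorphism of vectors and, by duality, of $1$-forms. On $1$-forms $(J\alpha)(X)=-\alpha(JX)$; $\theta=J\delta\omega$ is the Lee form (equivalently $d\omega=\theta\wedge\omega$). $N(A,B)=[JA,JB]-[A,B]-J[JA,B]-J[A,JB]$ is the Nijenhuis tensor, $\mathrm{Im}\,N\subset TM$ the span of its values at each point, and $|N|^2=\frac12\sum_{i,j}|N(e_i,e_j)|^2$ in an orthonormal basis; $2$-forms carry the scalar product with $|e^1\wedge e^2|=1$. Put $\rho(X,Y)=\mathrm{Ric}'(JX,Y)$ with $\mathrm{Ric}'$ the $J$-invariant part of $\mathrm{Ric}$;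 $\rho^*=R(\omega)$, i.e. $\rho^*(X,Y)=\frac12\sum_i g(R_{X,Y}e_i,Je_i)$; and $\Phi(X,Y)=\frac12\langle J(\nabla_X\omega),\nabla_Y\omega\rangle$, where $(J\psi)(A,B)=-\psi(JA,B)$ for a $J$-anti-invariant $2$-form $\psi$. Let $\omega|_{\mathrm{Im}\,N}$ be the restriction of $\omega$ to $\mathrm{Im}\,N$, extended by zero on the orthogonal complement. Suppose that $(M,g,J,\omega)$ is of class $\mathcal{AH}_1$, that is, $R_{XYZW}=R_{XYJZJW}$ for all $X,Y,Z,W$. Then: (a) $\mathrm{Ric}_0(\theta)=-\frac s4\theta$ and $\mathrm{Ric}_0(J\theta)=-\frac s4 J\theta$. (b) At all points where $s\neq 0$, $\mathrm{Span}(\theta,J\theta)$ (identified with a space of vectors by the metric) and $\mathrm{Im}\,N$ are orthogonal. (c) $\mathrm{Ric}_0(X)=\frac s4X$ for every $X\in\mathrm{Im}\,N$ (at every point). (d) At each point where $s=0$, either $\mathrm{Ric}=0$, or both $\theta=0$ and $N=0$. (e) $d\rho=0$ and $d\Phi=0$ on $M$, and at each point $\rho$ and $\Phi$ are collinear or one of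 them is zero (that is, they are linearly dependent). At points where $s\neq0$, $\theta\neq0$ and $N\neq0$, $$\rho=\frac s2\,\omega|_{\mathrm{Im}\,N},\qquad \Phi=\frac14\Big(|\theta|^2-\frac14|N|^2\Big)\,\omega|_{\mathrm{Im}\,N}=-\frac12(\delta\theta)\,\omega|_{\mathrm{Im}\,N}.$$ (f) $\rho^*\wedge\Phi=0$ at every point of $M$. -/

import Mathlib

open scoped Manifold ContDiff
open Bundle

noncomputable section

/-- The model space of a 4-manifold. -/
abbrev R4 : Type := EuclideanSpace ℝ (Fin 4)

/-! ### Almost Hermitian 4-manifolds -/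

/-- An almost Hermitian structure on a smooth 4-manifold: a smooth Riemannian metric `g` and a
smooth `g`-orthogonal almost complex structure `J`. -/
structure AlmostHermitian (M : Type*) [TopologicalSpace M] [ChartedSpace R4 M]
    [IsManifold (𝓡 4) ∞ M] where
  /-- the Riemannian metric -/
  g : ContMDiffRiemannianMetric (𝓡 4) ∞ R4 (fun p : M ↦ TangentSpace (𝓡 4) p)
  /-- the almost complex structure -/
  J : ∀ p : M, TangentSpace (𝓡 4) p →L[ℝ] TangentSpace (𝓡 4) p
  smooth_J : ContMDiff (𝓡 4) ((𝓡 4).prod 𝓘(ℝ, R4 →L[ℝ] R4)) ∞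
    (fun p ↦ TotalSpace.mk' (R4 →L[ℝ] R4)
      (E := fun p : M ↦ TangentSpace (𝓡 4) p →L[ℝ] TangentSpace (𝓡 4) p) p (J p))
  J_sq : ∀ (p : M) (v : TangentSpace (𝓡 4) p), J p (J p v) = -v
  J_orth : ∀ (p : M) (v w : TangentSpace (𝓡 4) p), g.inner p (J p v) (J p w) = g.inner p v w

/-- The expression in a chart of a metric and an almost complex structure: at a point `x` of the
chart's target, `g x` is a scalar product and `J x` an endomorphism of the space `R4` of
coordinate vectors. -/
structure Coord where
  /-- the metric in coordinates -/
  g : R4 → R4 → R4 → ℝ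
  /-- the almost complex structure in coordinates -/
  J : R4 → R4 → R4

/-- The expression of an almost Hermitian structure in the chart `e`: `g` is pulled back by the
inverse chart, and `J` is conjugated by the differential of the chart. -/
def AlmostHermitian.inChart {M : Type*} [TopologicalSpace M] [ChartedSpace R4 M]
    [IsManifold (𝓡 4) ∞ M] (A : AlmostHermitian M) (e : OpenPartialHomeomorph M R4) : Coord where
  g x u v := A.g.inner (e.symm x) (mfderiv (𝓡 4) (𝓡 4) e.symm x u)
    (mfderiv (𝓡 4) (𝓡 4) e.symm x v)
  J x u := mfderiv (𝓡 4) (𝓡 4) e (e.symm x)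
    (A.J (e.symm x) (mfderiv (𝓡 4) (𝓡 4) e.symm x u))

namespace Coord

/-! ### Tensor calculus in a chart

In what follows `x` is a point of the target of the chart, and `u v w z : R4` are coordinate
vectors at `x`, extended to constant coordinate vector fields wherever they are differentiated. -/

/-- The coordinate vector fields. -/
def basisVec (i : Fin 4) : R4 := EuclideanSpace.single i 1

/-- The directional derivative `∂_u f` at `x`. -/
def pd {F : Type*} [NormedAddCommGroup F] [NormedSpace ℝ F] (u : R4) (f : R4 → F) (x : R4) : F :=
  fderiv ℝ f x u

variable (c : Coord) (x : R4)

/-- The inverse metric `g^{ij}`. -/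
def ginv (i j : Fin 4) : ℝ :=
  (Matrix.of fun k l ↦ c.g x (basisVec k) (basisVec l))⁻¹ i j

/-- The metric trace `g^{ij} T(e_i, e_j)` of a bilinear form. -/
def tr (T : R4 → R4 → ℝ) : ℝ := ∑ i, ∑ j, c.ginv x i j * T (basisVec i) (basisVec j)

/-- The vector `α♯` dual to the 1-form `α`. -/
def sharp (α : R4 → ℝ) : R4 := ∑ i, ∑ j, (c.ginv x i j * α (basisVec i)) • basisVec j

/-- The scalar product of 1-forms. -/
def inner1 (α β : R4 → ℝ) : ℝ := c.tr x fun u v ↦ α u * β v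

/-- The scalar product of 2-forms `½ g^{ia} g^{jb} α_{ij} β_{ab}`,
normalized so that `|e¹ ∧ e²| = 1`. -/
def inner2 (α β : R4 → R4 → ℝ) : ℝ :=
  (1 / 2) * c.tr x fun u u' ↦ c.tr x fun v v' ↦ α u v * β u' v'

/-- The Christoffel symbols: `Γ(u, v) = ∇_u v` for constant coordinate fields. -/
def christoffel (u v : R4) : R4 :=
  c.sharp x fun w ↦ (1 / 2) * (pd u (fun y ↦ c.g y v w) x + pd v (fun y ↦ c.g y u w) x
    - pd w (fun y ↦ c.g y u v) x)

/-- The Levi-Civita derivative `(∇_u α)(v)` of a 1-form. -/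
def nabla1 (α : R4 → R4 → ℝ) (u v : R4) : ℝ :=
  pd u (fun y ↦ α y v) x - α x (c.christoffel x u v)

/-- The Levi-Civita derivative `(∇_u β)(v, w)` of a 2-form. -/
def nabla2 (β : R4 → R4 → R4 → ℝ) (u v w : R4) : ℝ :=
  pd u (fun y ↦ β y v w) x - β x (c.christoffel x u v) w - β x v (c.christoffel x u w)

/-- The codifferential of a 1-form, `δα = -∑ (∇_{e_i} α)(e_i)`. -/
def delta1 (α : R4 → R4 → ℝ) : ℝ := -c.tr x (c.nabla1 x α)

/-- The codifferential of a 2-form, `(δβ)(v) = -∑ (∇_{e_i} β)(e_i, v)`. -/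
def delta2 (β : R4 → R4 → R4 → ℝ) (v : R4) : ℝ :=
  -c.tr x fun u u' ↦ c.nabla2 x β u u' v

/-- The exterior derivative of a 2-form. -/
def extd (β : R4 → R4 → R4 → ℝ) (x u v w : R4) : ℝ :=
  pd u (fun y ↦ β y v w) x - pd v (fun y ↦ β y u w) x + pd w (fun y ↦ β y u v) x

/-- The wedge product of two 2-forms at a point. -/
def wedge (α β : R4 → R4 → ℝ) (u v w z : R4) : ℝ :=
  α u v * β w z - α u w * β v z + α u z * β v w
    + α v w * β u z - α v z * β u w + α w z * β u v

/-! ### Curvature -/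

/-- The curvature operator `R_{u,v} w`, with the sign `R_{X,Y} = ∇_{[X,Y]} - [∇_X, ∇_Y]`. -/
def curvOp (u v w : R4) : R4 :=
  -(pd u (fun y ↦ c.christoffel y v w) x + c.christoffel x u (c.christoffel x v w)
    - pd v (fun y ↦ c.christoffel y u w) x - c.christoffel x v (c.christoffel x u w))

/-- The curvature tensor `R_{uvwz} = g(R_{u,v} w, z)`; `R_{uvuv} > 0` on round spheres. -/
def curv (u v w z : R4) : ℝ := c.g x (c.curvOp x u v w) z

/-- The Ricci tensor (positive on round spheres). -/
def ricci (u v : R4) : ℝ := c.tr x fun w z ↦ c.curv x u w v z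

/-- The scalar curvature `s`. -/
def scal : ℝ := c.tr x (c.ricci x)

/-- The trace-free part `Ric₀ = Ric - (s/4) g` of the Ricci tensor. -/
def ricci0 (u v : R4) : ℝ := c.ricci x u v - c.scal x / 4 * c.g x u v

/-- `Ric₀` as an endomorphism of the tangent space. -/
def ricci0Vec (u : R4) : R4 := c.sharp x (c.ricci0 x u)

/-- `Ric₀` as an endomorphism of the space of 1-forms. -/
def ricci0Form (α : R4 → ℝ) (v : R4) : ℝ := c.ricci0 x (c.sharp x α) v

/-! ### The almost complex structure -/

/-- The action of `J` on 1-forms, `(Jα)(u) = -α(Ju)`. -/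
def Jform (α : R4 → ℝ) (u : R4) : ℝ := -α (c.J x u)

/-- The fundamental form `ω(u, v) = g(Ju, v)`. -/
def omega (u v : R4) : ℝ := c.g x (c.J x u) v

/-- The Lee form `θ = Jδω`. -/
def lee : R4 → ℝ := c.Jform x (c.delta2 x c.omega)

/-- The Nijenhuis tensor `N(u, v) = [Ju, Jv] - [u, v] - J[Ju, v] - J[u, Jv]`. -/
def nij (u v : R4) : R4 :=
  VectorField.lieBracket ℝ (fun y ↦ c.J y u) (fun y ↦ c.J y v) x
    - VectorField.lieBracket ℝ (fun _ ↦ u) (fun _ ↦ v) x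
    - c.J x (VectorField.lieBracket ℝ (fun y ↦ c.J y u) (fun _ ↦ v) x)
    - c.J x (VectorField.lieBracket ℝ (fun _ ↦ u) (fun y ↦ c.J y v) x)

/-- The image of the Nijenhuis tensor, a subspace of the tangent space. -/
def imN : Submodule ℝ R4 := Submodule.span ℝ {n | ∃ u v, n = c.nij x u v}

/-- `|N|²`, where `N` is viewed as a 2-form with values in the tangent space. -/
def nijNormSq : ℝ :=
  (1 / 2) * c.tr x fun u u' ↦ c.tr x fun v v' ↦ c.g x (c.nij x u v) (c.nij x u' v')

/-- The `g`-orthogonal projection of `u` onto the subspace `W`. -/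
def proj (W : Submodule ℝ R4) (u : R4) : R4 :=
  Classical.epsilon fun a ↦ a ∈ W ∧ ∀ w ∈ W, c.g x (u - a) w = 0

/-- The 2-form `ω|_W`: the fundamental form restricted to `W`, extended by `0` on the
orthogonal complement of `W`. -/
def omegaOn (W : Submodule ℝ R4) (u v : R4) : ℝ := c.omega x (c.proj x W u) (c.proj x W v)

/-- The Ricci form `ρ(u, v) = Ric'(Ju, v)`, where `Ric'` is the `J`-invariant part of `Ric`. -/
def rho (u v : R4) : ℝ :=
  (1 / 2) * (c.ricci x (c.J x u) v + c.ricci x (c.J x (c.J x u)) (c.J x v))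

/-- The star-Ricci form `ρ* = R(ω)`, the image of `ω` under the curvature operator on 2-forms. -/
def rhoStar (u v : R4) : ℝ := c.inner2 x (c.curv x u v) (c.omega x)

/-- The 2-form `Φ(u, v) = ½ ⟨J(∇_u ω), ∇_v ω⟩`, where `(Jψ)(X, Y) = -ψ(JX, Y)`. -/
def Phi (u v : R4) : ℝ :=
  (1 / 2) * c.inner2 x (fun a b ↦ -c.nabla2 x c.omega u (c.J x a) b) (c.nabla2 x c.omega v)

end Coord

/-- The class `AH₁`: Gray's first curvature condition `R_{XYZW} = R_{XY JZ JW}`. -/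
def AlmostHermitian.IsAH1 {M : Type*} [TopologicalSpace M] [ChartedSpace R4 M]
    [IsManifold (𝓡 4) ∞ M] (A : AlmostHermitian M) : Prop :=
  ∀ e ∈ IsManifold.maximalAtlas (𝓡 4) ∞ M, ∀ x ∈ e.target, ∀ u v w z : R4,
    (A.inChart e).curv x u v w z
      = (A.inChart e).curv x u v ((A.inChart e).J x w) ((A.inChart e).J x z)

end

/-!
In class `AH₁` the curvature endomorphisms commute with `J`. By the Ricci identity this makes `∇²J`
symmetric, which together with the second Bianchi identity gives `dρ* = 0` and `dΦ = 0`, while pair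
symmetry gives `ρ* = ρ`. Applied to `∇J`, the Ricci identity then shows that the cyclic sum of
`[R, ∇J]` vanishes. Since `∇J` takes values in the complex line of skew-adjoint antilinear
endomorphisms, on which `𝔲(2)` acts through its trace, this says that `ρ ∧ ∇J = 0`. Hence, at each
point, `∇J = 0`, or `Ric = 0`, or there is an orthonormal frame `(a, Ja, b, Jb)` in which `Ric` is
`s / 2` times the metric on the plane of `a, Ja` and zero on that of `b, Jb`, while `∇J` has
components along `a, Ja` only. In such a frame `θ`, `N` and `Φ` are read off.
-/

noncomputable section

open Filter Topology

set_option maxSynthPendingDepth 3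

/-! ### Connections on trivial bundles of algebras -/

theorem differentiableAt_of_smooth {E F : Type*} [NormedAddCommGroup E] [NormedSpace ℝ E]
    [NormedAddCommGroup F] [NormedSpace ℝ F] {f : E → F} {x : E} (hf : ContDiffAt ℝ ∞ f x) :
    DifferentiableAt ℝ f x :=
  hf.differentiableAt (by simp)

theorem contDiffAt_fderiv {E F : Type*} [NormedAddCommGroup E] [NormedSpace ℝ E]
    [NormedAddCommGroup F] [NormedSpace ℝ F] {f : E → F} {x : E} (hf : ContDiffAt ℝ ∞ f x) :
    ContDiffAt ℝ ∞ (fderiv ℝ f) x :=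
  hf.fderiv_right (by norm_num)

theorem fderiv_clm_apply_const {E F G : Type*} [NormedAddCommGroup E] [NormedSpace ℝ E]
    [NormedAddCommGroup F] [NormedSpace ℝ F] [NormedAddCommGroup G] [NormedSpace ℝ G]
    {L : E → F →L[ℝ] G} {x : E} (hL : DifferentiableAt ℝ L x) (u : E) (v : F) :
    fderiv ℝ (fun y ↦ L y v) x u = fderiv ℝ L x u v := by
  simp [fderiv_clm_apply hL (differentiableAt_const v)]

theorem fderiv_fderiv_comm {E F : Type*} [NormedAddCommGroup E] [NormedSpace ℝ E]
    [NormedAddCommGroup F] [NormedSpace ℝ F] {f : E → F} {x : E} (hf : ContDiffAt ℝ ∞ f x)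
    (u v : E) : fderiv ℝ (fderiv ℝ f) x u v = fderiv ℝ (fderiv ℝ f) x v u :=
  (hf.isSymmSndFDerivAt (by simpa using WithTop.coe_le_coe.2 (le_top : (2 : ℕ∞) ≤ ⊤))).eq u v

section Connection

variable {E 𝔸 : Type*} [NormedAddCommGroup E] [NormedSpace ℝ E] [NormedRing 𝔸]
  [NormedAlgebra ℝ 𝔸] (Γ : E → E →L[ℝ] 𝔸)

/-- The covariant derivative `D_u A = ∂_u A + [Γ(u), A]` of an `𝔸`-valued function, for the
connection with connection form `Γ`. -/
def covD (A : E → 𝔸) (x : E) : E →L[ℝ] 𝔸 :=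
  fderiv ℝ A x
    + ((ContinuousLinearMap.mul ℝ 𝔸).flip (A x) - ContinuousLinearMap.mul ℝ 𝔸 (A x)) ∘L Γ x

/-- The curvature form of the connection with connection form `Γ`. -/
def curvForm (x u v : E) : 𝔸 := fderiv ℝ Γ x u v - fderiv ℝ Γ x v u + ⁅Γ x u, Γ x v⁆

variable {Γ} {x : E} {A B J : E → 𝔸}

theorem covD_apply (u : E) : covD Γ A x u = fderiv ℝ A x u + ⁅Γ x u, A x⁆ := rfl

theorem contDiffAt_covD (hΓ : ContDiffAt ℝ ∞ Γ x) (hA : ContDiffAt ℝ ∞ A x) :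
    ContDiffAt ℝ ∞ (covD Γ A) x :=
  (contDiffAt_fderiv hA).add
    ((((ContinuousLinearMap.contDiff _).contDiffAt.comp x hA).sub
      ((ContinuousLinearMap.contDiff _).contDiffAt.comp x hA)).clm_comp hΓ)

theorem contDiffAt_curvForm (hΓ : ContDiffAt ℝ ∞ Γ x) (u v : E) :
    ContDiffAt ℝ ∞ (fun y ↦ curvForm Γ y u v) x := by
  simp only [curvForm, Ring.lie_def]
  have h := contDiffAt_fderiv hΓ
  exact (((h.clm_apply contDiffAt_const).clm_apply contDiffAt_const).sub
    ((h.clm_apply contDiffAt_const).clm_apply contDiffAt_const)).add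
    (((hΓ.clm_apply contDiffAt_const).mul (hΓ.clm_apply contDiffAt_const)).sub
    ((hΓ.clm_apply contDiffAt_const).mul (hΓ.clm_apply contDiffAt_const)))

theorem curvForm_antisymm (u v : E) : curvForm Γ x u v = -curvForm Γ x v u := by
  simp only [curvForm, Ring.lie_def]
  abel

theorem covD_congr (h : A =ᶠ[𝓝 x] B) : covD Γ A x = covD Γ B x := by
  rw [covD, covD, h.fderiv_eq, h.eq_of_nhds]

theorem covD_neg (u : E) : covD Γ (fun y ↦ -A y) x u = -covD Γ A x u := by
  simp only [covD_apply, fderiv_fun_neg, neg_apply, Ring.lie_def]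
  noncomm_ring

theorem covD_add (hA : DifferentiableAt ℝ A x) (hB : DifferentiableAt ℝ B x) (u : E) :
    covD Γ (fun y ↦ A y + B y) x u = covD Γ A x u + covD Γ B x u := by
  simp only [covD_apply, fderiv_fun_add hA hB, add_apply, Ring.lie_def]
  noncomm_ring

theorem covD_mul (hA : DifferentiableAt ℝ A x) (hB : DifferentiableAt ℝ B x) (u : E) :
    covD Γ (fun y ↦ A y * B y) x u = covD Γ A x u * B x + A x * covD Γ B x u := by
  simp only [covD_apply, fderiv_fun_mul' hA hB, add_apply, smul_apply, smul_eq_mul,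
    MulOpposite.smul_eq_mul_unop, MulOpposite.unop_op, Ring.lie_def]
  noncomm_ring

theorem fderiv_lie (hA : DifferentiableAt ℝ A x) (hB : DifferentiableAt ℝ B x) (u : E) :
    fderiv ℝ (fun y ↦ ⁅A y, B y⁆) x u = ⁅fderiv ℝ A x u, B x⁆ + ⁅A x, fderiv ℝ B x u⁆ := by
  simp only [Ring.lie_def, fderiv_fun_sub (hA.fun_mul hB) (hB.fun_mul hA), fderiv_fun_mul' hA hB,
    fderiv_fun_mul' hB hA, add_apply, sub_apply, smul_apply, smul_eq_mul,
    MulOpposite.smul_eq_mul_unop, MulOpposite.unop_op]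
  noncomm_ring

theorem fderiv_covD (hΓ : ContDiffAt ℝ ∞ Γ x) (hA : ContDiffAt ℝ ∞ A x) (u v : E) :
    fderiv ℝ (fun y ↦ covD Γ A y v) x u
      = fderiv ℝ (fderiv ℝ A) x u v + ⁅fderiv ℝ Γ x u v, A x⁆ + ⁅Γ x v, fderiv ℝ A x u⁆ := by
  have dA := differentiableAt_of_smooth hA
  have dfA := differentiableAt_of_smooth (contDiffAt_fderiv hA)
  have dΓ := differentiableAt_of_smooth hΓ
  simp only [covD_apply]
  rw [fderiv_fun_add (dfA.clm_apply (differentiableAt_const v)), add_apply,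
    fderiv_clm_apply_const dfA, fderiv_lie (dΓ.clm_apply (differentiableAt_const v)) dA,
    fderiv_clm_apply_const dΓ, add_assoc]
  simp only [Ring.lie_def]
  fun_prop

theorem ricci_identity (hΓ : ContDiffAt ℝ ∞ Γ x) (hA : ContDiffAt ℝ ∞ A x) (u v : E) :
    covD Γ (fun y ↦ covD Γ A y v) x u - covD Γ (fun y ↦ covD Γ A y u) x v
      = ⁅curvForm Γ x u v, A x⁆ := by
  rw [covD_apply u, covD_apply (A := fun y ↦ covD Γ A y u) v, fderiv_covD hΓ hA,
    fderiv_covD hΓ hA, fderiv_fderiv_comm hA u v]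
  simp only [covD_apply, curvForm, Ring.lie_def]
  noncomm_ring

theorem second_bianchi_identity (hΓ : ContDiffAt ℝ ∞ Γ x) (u v w : E) :
    covD Γ (fun y ↦ curvForm Γ y u v) x w + covD Γ (fun y ↦ curvForm Γ y v w) x u
      + covD Γ (fun y ↦ curvForm Γ y w u) x v = 0 := by
  have dΓ := differentiableAt_of_smooth hΓ
  have dfΓ := differentiableAt_of_smooth (contDiffAt_fderiv hΓ)
  have h : ∀ u v w, fderiv ℝ (fun y ↦ curvForm Γ y u v) x w =
      fderiv ℝ (fderiv ℝ Γ) x w u v - fderiv ℝ (fderiv ℝ Γ) x w v u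
        + (⁅fderiv ℝ Γ x w u, Γ x v⁆ + ⁅Γ x u, fderiv ℝ Γ x w v⁆) := fun u v w ↦ by
    have d : ∀ u v, DifferentiableAt ℝ (fun y ↦ fderiv ℝ Γ y u v) x := fun u v ↦ by fun_prop
    have dl : DifferentiableAt ℝ (fun y ↦ ⁅Γ y u, Γ y v⁆) x := by
      simp only [Ring.lie_def]
      fun_prop
    simp only [curvForm]
    rw [fderiv_fun_add ((d u v).fun_sub (d v u)) dl, fderiv_fun_sub (d u v) (d v u), add_apply,
      sub_apply, fderiv_lie (by fun_prop) (by fun_prop), fderiv_clm_apply_const (by fun_prop),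
      fderiv_clm_apply_const (by fun_prop), fderiv_clm_apply_const (by fun_prop),
      fderiv_clm_apply_const (by fun_prop), fderiv_clm_apply_const dΓ, fderiv_clm_apply_const dΓ]
  simp only [covD_apply, h]
  rw [fderiv_fderiv_comm hΓ w u, fderiv_fderiv_comm hΓ w v, fderiv_fderiv_comm hΓ u v]
  simp only [curvForm, Ring.lie_def]
  noncomm_ring

theorem covD_covD_comm (hΓ : ContDiffAt ℝ ∞ Γ x) (hJ : ContDiffAt ℝ ∞ J x) {u v : E}
    (hR : ⁅curvForm Γ x u v, J x⁆ = 0) :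
    covD Γ (fun y ↦ covD Γ J y v) x u = covD Γ (fun y ↦ covD Γ J y u) x v := by
  rw [← sub_eq_zero, ricci_identity hΓ hJ, hR]

/-- As `[R, J] = 0` makes `D²J` symmetric, the commutators of the Ricci identity for `DJ` cancel
cyclically. -/
theorem lie_curvForm_covD_cyclic (hΓ : ∀ᶠ y in 𝓝 x, ContDiffAt ℝ ∞ Γ y)
    (hJ : ∀ᶠ y in 𝓝 x, ContDiffAt ℝ ∞ J y)
    (hR : ∀ᶠ y in 𝓝 x, ∀ u v, ⁅curvForm Γ y u v, J y⁆ = 0) (u v w : E) :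
    ⁅curvForm Γ x u v, covD Γ J x w⁆ + ⁅curvForm Γ x v w, covD Γ J x u⁆
      + ⁅curvForm Γ x w u, covD Γ J x v⁆ = 0 := by
  have hΓx := hΓ.self_of_nhds
  have hK : ∀ w, ContDiffAt ℝ ∞ (fun y ↦ covD Γ J y w) x := fun w ↦
    (contDiffAt_covD hΓx hJ.self_of_nhds).clm_apply contDiffAt_const
  have hs : ∀ u v, ∀ᶠ y in 𝓝 x,
      covD Γ (fun z ↦ covD Γ J z v) y u = covD Γ (fun z ↦ covD Γ J z u) y v := fun u v ↦ by
    filter_upwards [hΓ, hJ, hR] with y h₁ h₂ h₃ using covD_covD_comm h₁ h₂ (h₃ u v)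
  rw [← ricci_identity hΓx (hK w), ← ricci_identity hΓx (hK u), ← ricci_identity hΓx (hK v),
    covD_congr (hs v w), covD_congr (hs u w), covD_congr (hs u v)]
  abel

theorem covD_mul_of_sq_eq_neg_one (hJ : DifferentiableAt ℝ J x)
    (hsq : ∀ᶠ y in 𝓝 x, J y * J y = -1) (u : E) :
    covD Γ J x u * J x = -(J x * covD Γ J x u) := by
  have h : covD Γ (fun y ↦ J y * J y) x u = 0 := by
    rw [covD_congr (B := fun _ ↦ -1) hsq, covD_apply]
    simp [Ring.lie_def]
  rwa [covD_mul hJ hJ, add_eq_zero_iff_eq_neg] at h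

theorem covD_covD_mul_of_sq_eq_neg_one (hΓ : ContDiffAt ℝ ∞ Γ x)
    (hJ : ∀ᶠ y in 𝓝 x, ContDiffAt ℝ ∞ J y) (hsq : ∀ᶠ y in 𝓝 x, J y * J y = -1) (w u : E) :
    covD Γ (fun y ↦ covD Γ J y u) x w * J x + J x * covD Γ (fun y ↦ covD Γ J y u) x w
      = -(covD Γ J x u * covD Γ J x w + covD Γ J x w * covD Γ J x u) := by
  have dJ := differentiableAt_of_smooth hJ.self_of_nhds
  have dK : DifferentiableAt ℝ (fun y ↦ covD Γ J y u) x := differentiableAt_of_smooth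
    ((contDiffAt_covD hΓ hJ.self_of_nhds).clm_apply contDiffAt_const)
  have h : covD Γ (fun y ↦ covD Γ J y u * J y + J y * covD Γ J y u) x w = 0 := by
    rw [covD_congr (B := fun _ ↦ 0), covD_apply]
    · simp [Ring.lie_def]
    · filter_upwards [hJ, hsq.eventually_nhds] with y hy hy'
      rw [covD_mul_of_sq_eq_neg_one (differentiableAt_of_smooth hy) hy', neg_add_cancel]
  rw [covD_add (dK.fun_mul dJ) (dJ.fun_mul dK), covD_mul dK dJ, covD_mul dJ dK] at h
  rw [← sub_eq_zero, ← h]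
  noncomm_ring

section Trace

variable {τ : 𝔸 →L[ℝ] ℝ} (hτ : ∀ a b, τ (a * b) = τ (b * a))

include hτ

theorem trace_mul_eq_zero_of_anticommute {J A B : 𝔸} (hJ : J * J = -1) (hA : ⁅A, J⁆ = 0)
    (hB : B * J = -(J * B)) : τ (A * B) = 0 := by
  have hA : A * J = J * A := sub_eq_zero.1 hA
  have h : τ (A * B) = -τ (A * B) :=
    calc τ (A * B) = -τ (J * J * A * B) := by simp [hJ]
      _ = -τ (J * (A * (J * B))) := by rw [mul_assoc J J A, ← hA]; simp only [mul_assoc]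
      _ = τ (J * (A * B) * J) := by rw [← neg_eq_iff_eq_neg.2 hB]; simp [mul_assoc]
      _ = -τ (A * B) := by rw [hτ, ← mul_assoc, hJ]; simp
  linarith

theorem fderiv_trace (hA : DifferentiableAt ℝ A x) (u : E) :
    fderiv ℝ (fun y ↦ τ (A y)) x u = τ (covD Γ A x u) := by
  have h : fderiv ℝ (fun y ↦ τ (A y)) x u = τ (fderiv ℝ A x u) :=
    DFunLike.congr_fun (τ.hasFDerivAt.comp x hA.hasFDerivAt).fderiv u
  rw [h, covD_apply, Ring.lie_def, map_add, map_sub, hτ (Γ x u), sub_self, add_zero]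

end Trace

end Connection

section Closed

variable {𝔸 : Type*} [NormedRing 𝔸] [NormedAlgebra ℝ 𝔸] {Γ : R4 → R4 →L[ℝ] 𝔸} {x : R4}
  {J : R4 → 𝔸} {τ : 𝔸 →L[ℝ] ℝ}

open Coord

theorem extd_trace_curvForm (hτ : ∀ a b, τ (a * b) = τ (b * a)) (hΓ : ContDiffAt ℝ ∞ Γ x)
    (hJ : ContDiffAt ℝ ∞ J x) (hsq : ∀ᶠ y in 𝓝 x, J y * J y = -1)
    (hR : ∀ u v, ⁅curvForm Γ x u v, J x⁆ = 0) (u v w : R4) :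
    extd (fun y u v ↦ τ (J y * curvForm Γ y u v)) x u v w = 0 := by
  have dJ := differentiableAt_of_smooth hJ
  have dR := fun u v ↦ differentiableAt_of_smooth (contDiffAt_curvForm hΓ u v)
  have h : ∀ u v w, pd w (fun y ↦ τ (J y * curvForm Γ y u v)) x
      = τ (J x * covD Γ (fun y ↦ curvForm Γ y u v) x w) := fun u v w ↦ by
    rw [pd, fderiv_trace (Γ := Γ) hτ (dJ.fun_mul (dR u v)), covD_mul dJ (dR u v), map_add, hτ,
      trace_mul_eq_zero_of_anticommute hτ hsq.self_of_nhds (hR u v)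
        (covD_mul_of_sq_eq_neg_one dJ hsq w), zero_add]
  have hcyc := second_bianchi_identity hΓ u v w
  rw [funext fun y ↦ curvForm_antisymm (Γ := Γ) (x := y) w u, covD_neg] at hcyc
  simp only [extd, h]
  rw [← map_sub, ← map_add, ← mul_sub, ← mul_add, ← map_zero τ, ← mul_zero (J x), ← hcyc]
  congr 2
  abel

/-- The derivatives of `K = DJ` occur in pairs `τ(J DK K) + τ(J K DK)`, which vanish because
`DK` anticommutes with `J` up to a term quadratic in `K`. -/
theorem extd_trace_covD (hτ : ∀ a b, τ (a * b) = τ (b * a)) (hΓ : ContDiffAt ℝ ∞ Γ x)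
    (hJ : ∀ᶠ y in 𝓝 x, ContDiffAt ℝ ∞ J y) (hsq : ∀ᶠ y in 𝓝 x, J y * J y = -1)
    (hR : ∀ u v, ⁅curvForm Γ x u v, J x⁆ = 0) (u v w : R4) :
    extd (fun y u v ↦ τ (J y * (covD Γ J y v * covD Γ J y u))) x u v w = 0 := by
  have hJx := hJ.self_of_nhds
  have hJJ := hsq.self_of_nhds
  have dJ := differentiableAt_of_smooth hJx
  have dK : ∀ u, DifferentiableAt ℝ (fun y ↦ covD Γ J y u) x := fun u ↦
    differentiableAt_of_smooth ((contDiffAt_covD hΓ hJx).clm_apply contDiffAt_const)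
  have hK := covD_mul_of_sq_eq_neg_one (Γ := Γ) dJ hsq
  have hKK : ∀ u v, ⁅covD Γ J x v * covD Γ J x u, J x⁆ = 0 := fun u v ↦ by
    rw [Ring.lie_def, mul_assoc, hK, mul_neg, ← mul_assoc, hK, neg_mul, neg_neg, mul_assoc,
      sub_self]
  set D : R4 → R4 → 𝔸 := fun w u ↦ covD Γ (fun y ↦ covD Γ J y u) x w
  have hDcomm : ∀ u v, D u v = D v u := fun u v ↦ covD_covD_comm hΓ hJx (hR u v)
  have h : ∀ u v w, pd w (fun y ↦ τ (J y * (covD Γ J y v * covD Γ J y u))) x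
      = τ (J x * (D w v * covD Γ J x u)) + τ (J x * (covD Γ J x v * D w u)) := fun u v w ↦ by
    rw [pd, fderiv_trace (Γ := Γ) hτ (dJ.fun_mul ((dK v).fun_mul (dK u))),
      covD_mul dJ ((dK v).fun_mul (dK u)), map_add, hτ,
      trace_mul_eq_zero_of_anticommute hτ hJJ (hKK u v) (hK w), zero_add,
      covD_mul (dK v) (dK u), mul_add, map_add]
  have hpair : ∀ u v w, τ (J x * (D w u * covD Γ J x v)) + τ (J x * (covD Γ J x v * D w u)) = 0 :=
    fun u v w ↦ by
      rw [hτ (J x) (covD Γ J x v * D w u), mul_assoc, hτ (covD Γ J x v), ← mul_assoc, ← map_add,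
        ← add_mul, add_comm, covD_covD_mul_of_sq_eq_neg_one hΓ hJ hsq w u, neg_mul, add_mul,
        map_neg, map_add, trace_mul_eq_zero_of_anticommute hτ hJJ (hKK w u) (hK v),
        trace_mul_eq_zero_of_anticommute hτ hJJ (hKK u w) (hK v), add_zero, neg_zero]
  simp only [extd, h, hDcomm u w, hDcomm u v, hDcomm v w]
  linarith [hpair v u w, hpair w u v, hpair w v u, hpair u w v, hpair v w u, hpair u v w]

end Closed

/-- An almost Hermitian structure on an open subset of `R4`: the form in which the structure of a
4-manifold is seen in a chart. The fields are total functions, meaningful on `domain` only. -/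
structure LocalAlmostHermitian where
  domain : Set R4
  metric : R4 → R4 →L[ℝ] R4 →L[ℝ] ℝ
  J : R4 → R4 →L[ℝ] R4
  isOpen_domain : IsOpen domain
  contDiffOn_metric : ContDiffOn ℝ ∞ metric domain
  contDiffOn_J : ContDiffOn ℝ ∞ J domain
  symm : ∀ y ∈ domain, ∀ u v, metric y u v = metric y v u
  pos : ∀ y ∈ domain, ∀ u, u ≠ 0 → 0 < metric y u u
  J_J_apply : ∀ y ∈ domain, ∀ u, J y (J y u) = -u
  metric_J_J : ∀ y ∈ domain, ∀ u v, metric y (J y u) (J y v) = metric y u v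

/-- The coordinate expression of a local almost Hermitian structure. -/
def LocalAlmostHermitian.coord (S : LocalAlmostHermitian) : Coord where
  g y u v := S.metric y u v
  J y u := S.J y u

@[simp] theorem LocalAlmostHermitian.coord_g (S : LocalAlmostHermitian) (y u v : R4) :
    S.coord.g y u v = S.metric y u v := rfl

@[simp] theorem LocalAlmostHermitian.coord_J (S : LocalAlmostHermitian) (y u : R4) :
    S.coord.J y u = S.J y u := rfl

section Chart

variable {M : Type*} [TopologicalSpace M] [ChartedSpace R4 M] [IsManifold (𝓡 4) ∞ M]
  (A : AlmostHermitian M) (e : OpenPartialHomeomorph M R4)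

/-- The differential of the inverse chart. -/
def chartSymmDeriv (y : R4) : R4 →L[ℝ] R4 := mfderiv (𝓡 4) (𝓡 4) e.symm y

/-- The differential of the chart. -/
def chartDeriv (y : R4) : R4 →L[ℝ] R4 := mfderiv (𝓡 4) (𝓡 4) e (e.symm y)

/-- The metric in a chart, as a field of continuous bilinear forms. -/
def AlmostHermitian.chartMetric (y : R4) : R4 →L[ℝ] R4 →L[ℝ] ℝ :=
  ContinuousLinearMap.bilinearComp (E := R4) (F := R4) (G := ℝ) (A.g.inner (e.symm y))
    (chartSymmDeriv e y) (chartSymmDeriv e y)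

/-- The almost complex structure in a chart, as a field of continuous endomorphisms. -/
def AlmostHermitian.chartJ (y : R4) : R4 →L[ℝ] R4 :=
  (chartDeriv e y).comp
    (ContinuousLinearMap.comp (M₂ := R4) (A.J (e.symm y)) (chartSymmDeriv e y))

variable {e}

theorem contMDiffOn_chartSymmDeriv_apply (he : e ∈ IsManifold.maximalAtlas (𝓡 4) ∞ M)
    (u : R4) :
    ContMDiffOn (𝓡 4) ((𝓡 4).prod 𝓘(ℝ, R4)) ∞
      (fun y ↦ TotalSpace.mk' R4 (E := fun p : M ↦ TangentSpace (𝓡 4) p) (e.symm y)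
        (mfderiv (𝓡 4) (𝓡 4) e.symm y u)) e.target := by
  have h := (contMDiffOn_symm_of_mem_maximalAtlas he).contMDiffOn_tangentMapWithin
    (m := ∞) (by norm_num) e.open_target.uniqueMDiffOn
  have hs : ContMDiff (𝓡 4) ((𝓡 4).prod 𝓘(ℝ, R4)) ∞
      (fun y : R4 ↦ (TotalSpace.mk' R4 y u : TangentBundle (𝓡 4) R4)) := by
    intro y
    refine contMDiffAt_totalSpace.2 ⟨contMDiffAt_id, ?_⟩
    simpa using contMDiffAt_const
  have := h.comp (hs.contMDiffOn (s := e.target)) (fun y hy ↦ hy)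
  refine this.congr fun y hy ↦ ?_
  simp [tangentMapWithin, mfderivWithin_of_isOpen e.open_target hy]

theorem contDiffOn_chartDeriv_apply (he : e ∈ IsManifold.maximalAtlas (𝓡 4) ∞ M)
    (v : ∀ y : R4, TangentSpace (𝓡 4) (e.symm y))
    (hv : ContMDiffOn (𝓡 4) ((𝓡 4).prod 𝓘(ℝ, R4)) ∞
      (fun y ↦ TotalSpace.mk' R4 (E := fun p : M ↦ TangentSpace (𝓡 4) p) (e.symm y) (v y))
      e.target) :
    ContDiffOn ℝ ∞ (fun y ↦ (chartDeriv e y (v y) : R4)) e.target := by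
  have h := (contMDiffOn_of_mem_maximalAtlas he).contMDiffOn_tangentMapWithin
    (m := ∞) (by norm_num) e.open_source.uniqueMDiffOn
  have hcomp := h.comp hv (fun y hy ↦ e.map_target hy)
  rw [← contMDiffOn_iff_contDiffOn]
  intro y hy
  have hsnd := (contMDiffWithinAt_totalSpace.1 (hcomp y hy)).2
  have htriv : ∀ z ∈ e.target, chartDeriv e z (v z) =
      (trivializationAt R4 (TangentSpace (𝓡 4)) y
        (tangentMapWithin (𝓡 4) (𝓡 4) e e.source ⟨e.symm z, v z⟩)).2 := fun z hz ↦ by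
    simp only [tangentMapWithin, mfderivWithin_of_isOpen e.open_source (e.map_target hz),
      chartDeriv, trivializationAt_model_space_apply]
    rfl
  have hproj : (tangentMapWithin (𝓡 4) (𝓡 4) e e.source ⟨e.symm y, v y⟩).proj = y :=
    e.right_inv hy
  simp only [Function.comp_apply, hproj] at hsnd
  exact hsnd.congr htriv (htriv y hy)

theorem AlmostHermitian.contDiffOn_chartMetric (he : e ∈ IsManifold.maximalAtlas (𝓡 4) ∞ M) :
    ContDiffOn ℝ ∞ (A.chartMetric e) e.target := by
  rw [contDiffOn_clm_apply]
  intro u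
  rw [contDiffOn_clm_apply]
  intro v
  rw [← contMDiffOn_iff_contDiffOn]
  intro y hy
  have hb := (contMDiffOn_symm_of_mem_maximalAtlas he) y hy
  have : ContMDiffWithinAt (𝓡 4) ((𝓡 4).prod 𝓘(ℝ)) ∞
      (fun m ↦ TotalSpace.mk' ℝ (E := Bundle.Trivial M ℝ) (e.symm m)
        (A.g.inner (e.symm m) (mfderiv (𝓡 4) (𝓡 4) e.symm m u)
          (mfderiv (𝓡 4) (𝓡 4) e.symm m v))) e.target y := by
    apply ContMDiffWithinAt.clm_bundle_apply₂ (F₁ := R4) (F₂ := R4)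
    · exact ContMDiffAt.comp_contMDiffWithinAt y A.g.contMDiff.contMDiffAt hb
    · exact contMDiffOn_chartSymmDeriv_apply he u y hy
    · exact contMDiffOn_chartSymmDeriv_apply he v y hy
  exact (contMDiffWithinAt_totalSpace.1 this).2

theorem AlmostHermitian.contDiffOn_chartJ (he : e ∈ IsManifold.maximalAtlas (𝓡 4) ∞ M) :
    ContDiffOn ℝ ∞ (A.chartJ e) e.target := by
  rw [contDiffOn_clm_apply]
  intro u
  refine contDiffOn_chartDeriv_apply he
    (fun y ↦ A.J (e.symm y) (mfderiv (𝓡 4) (𝓡 4) e.symm y u)) fun y hy ↦ ?_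
  have hb := (contMDiffOn_symm_of_mem_maximalAtlas he) y hy
  exact ContMDiffWithinAt.clm_bundle_apply (F₁ := R4) (F₂ := R4)
    (ContMDiffAt.comp_contMDiffWithinAt y A.smooth_J.contMDiffAt hb)
    (contMDiffOn_chartSymmDeriv_apply he u y hy)

omit [IsManifold (𝓡 4) ∞ M] in
theorem mdifferentiable_of_mem_maximalAtlas (he : e ∈ IsManifold.maximalAtlas (𝓡 4) ∞ M) :
    e.MDifferentiable (𝓡 4) (𝓡 4) :=
  ⟨(contMDiffOn_of_mem_maximalAtlas he).mdifferentiableOn (by simp),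
    (contMDiffOn_symm_of_mem_maximalAtlas he).mdifferentiableOn (by simp)⟩

omit [IsManifold (𝓡 4) ∞ M] in
theorem chartDeriv_chartSymmDeriv (he : e ∈ IsManifold.maximalAtlas (𝓡 4) ∞ M) {y : R4}
    (hy : y ∈ e.target) (u : R4) : chartDeriv e y (chartSymmDeriv e y u) = u :=
  DFunLike.congr_fun ((mdifferentiable_of_mem_maximalAtlas he).comp_symm_deriv hy) u

omit [IsManifold (𝓡 4) ∞ M] in
theorem chartSymmDeriv_chartDeriv (he : e ∈ IsManifold.maximalAtlas (𝓡 4) ∞ M) {y : R4}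
    (hy : y ∈ e.target) (u : R4) : chartSymmDeriv e y (chartDeriv e y u) = u := by
  have h := (mdifferentiable_of_mem_maximalAtlas he).symm_comp_deriv (e.map_target hy)
  rw [e.right_inv hy] at h
  exact DFunLike.congr_fun h u

theorem AlmostHermitian.chartSymmDeriv_chartJ (he : e ∈ IsManifold.maximalAtlas (𝓡 4) ∞ M)
    {y : R4} (hy : y ∈ e.target) (u : R4) :
    chartSymmDeriv e y (A.chartJ e y u) = A.J (e.symm y) (chartSymmDeriv e y u) :=
  chartSymmDeriv_chartDeriv he hy _

/-- The almost Hermitian structure of a manifold in a chart, on the target of the chart. -/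
def AlmostHermitian.toLocal (he : e ∈ IsManifold.maximalAtlas (𝓡 4) ∞ M) :
    LocalAlmostHermitian where
  domain := e.target
  metric := A.chartMetric e
  J := A.chartJ e
  isOpen_domain := e.open_target
  contDiffOn_metric := A.contDiffOn_chartMetric he
  contDiffOn_J := A.contDiffOn_chartJ he
  symm y _ u v := A.g.symm _ _ _
  pos y hy u hu := by
    refine A.g.pos (e.symm y) (chartSymmDeriv e y u) fun h ↦ hu ?_
    rw [← chartDeriv_chartSymmDeriv he hy u]
    exact (congrArg (chartDeriv e y) h).trans (map_zero _)
  J_J_apply y hy u := calc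
    A.chartJ e y (A.chartJ e y u)
      = chartDeriv e y (A.J (e.symm y) (A.J (e.symm y) (chartSymmDeriv e y u))) :=
        congrArg (fun v ↦ chartDeriv e y (A.J (e.symm y) v)) (A.chartSymmDeriv_chartJ he hy u)
    _ = chartDeriv e y (-chartSymmDeriv e y u) := congrArg (chartDeriv e y) (A.J_sq _ _)
    _ = -u := by rw [map_neg, chartDeriv_chartSymmDeriv he hy]
  metric_J_J y hy u v := calc
    A.chartMetric e y (A.chartJ e y u) (A.chartJ e y v)
      = A.g.inner (e.symm y) (A.J (e.symm y) (chartSymmDeriv e y u))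
          (A.J (e.symm y) (chartSymmDeriv e y v)) :=
        congrArg₂ (fun a b ↦ A.g.inner (e.symm y) a b) (A.chartSymmDeriv_chartJ he hy u)
          (A.chartSymmDeriv_chartJ he hy v)
    _ = A.chartMetric e y u v := A.J_orth _ _ _

end Chart

namespace Coord

theorem sum_smul_basisVec (u : R4) : ∑ i, u i • basisVec i = u := by
  simpa [basisVec] using (EuclideanSpace.basisFun (Fin 4) ℝ).sum_repr u

end Coord

/-- The trace of an endomorphism, as a continuous linear form. -/
def traceCLM : (R4 →L[ℝ] R4) →L[ℝ] ℝ :=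
  LinearMap.toContinuousLinearMap (LinearMap.trace ℝ R4 ∘ₗ ContinuousLinearMap.coeLM ℝ)

theorem traceCLM_mul_comm (A B : R4 →L[ℝ] R4) : traceCLM (A * B) = traceCLM (B * A) :=
  LinearMap.trace_mul_comm ℝ (A : R4 →ₗ[ℝ] R4) B

namespace LocalAlmostHermitian

open Coord

variable (S : LocalAlmostHermitian) {y : R4} {E : Fin 4 → R4}

/-! ### Orthonormal frames -/

/-- Orthonormal frames of the tangent space at `y`. -/
def IsFrame (y : R4) (E : Fin 4 → R4) : Prop :=
  ∀ i j, S.metric y (E i) (E j) = if i = j then 1 else 0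

/-- Orthonormal frames of the form `(a, Ja, b, Jb)`. -/
structure IsAdaptedFrame (y : R4) (E : Fin 4 → R4) : Prop where
  isFrame : S.IsFrame y E
  J_zero : S.J y (E 0) = E 1
  J_one : S.J y (E 1) = -E 0
  J_two : S.J y (E 2) = E 3
  J_three : S.J y (E 3) = -E 2

variable {S}

namespace IsFrame

variable (hE : S.IsFrame y E)

include hE

theorem linearIndependent : LinearIndependent ℝ E := by
  rw [Fintype.linearIndependent_iff]
  intro a ha i
  simpa [hE _ i] using congrArg (fun v ↦ S.metric y v (E i)) ha

/-- An orthonormal frame as a basis. -/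
def basis : Module.Basis (Fin 4) ℝ R4 :=
  basisOfLinearIndependentOfCardEqFinrank hE.linearIndependent (by simp)

theorem coe_basis : ⇑hE.basis = E :=
  coe_basisOfLinearIndependentOfCardEqFinrank hE.linearIndependent (by simp)

theorem basis_repr (u : R4) (k : Fin 4) : hE.basis.repr u k = S.metric y u (E k) := by
  conv_rhs => rw [← hE.basis.sum_repr u]
  simp [hE.coe_basis, hE _ k]

theorem sum_metric_smul (u : R4) : ∑ k, S.metric y u (E k) • E k = u := by
  simpa only [hE.basis_repr, hE.coe_basis] using hE.basis.sum_repr u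

theorem traceCLM_eq (L : R4 →L[ℝ] R4) : traceCLM L = ∑ k, S.metric y (L (E k)) (E k) := by
  have h : traceCLM L = LinearMap.trace ℝ R4 (L : R4 →ₗ[ℝ] R4) := rfl
  simp [h, LinearMap.trace_eq_matrix_trace ℝ hE.basis, Matrix.trace, LinearMap.toMatrix_apply,
    hE.basis_repr, hE.coe_basis]

theorem gram_mul : (Matrix.of fun k l ↦ S.coord.g y (basisVec k) (basisVec l))
    * ((Matrix.of fun i k ↦ E k i) * (Matrix.of fun i k ↦ E k i).transpose) = 1 := by
  rw [← mul_assoc]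
  apply mul_eq_one_comm.1
  ext k l
  have h := hE k l
  rw [← sum_smul_basisVec (E k), ← sum_smul_basisVec (E l)] at h
  simp only [map_sum, map_smul, sum_apply, smul_apply, smul_eq_mul, Finset.mul_sum] at h
  rw [Finset.sum_comm] at h
  simpa only [Matrix.mul_apply, Matrix.of_apply, Matrix.transpose_apply, Matrix.one_apply, coord_g,
    Finset.mul_sum, mul_comm, mul_left_comm] using h

theorem ginv_eq (i j : Fin 4) : S.coord.ginv y i j = ∑ k, E k i * E k j := by
  rw [ginv, Matrix.inv_eq_right_inv hE.gram_mul]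
  simp [Matrix.mul_apply]

theorem sum_ginv_smul {F : Type*} [AddCommGroup F] [Module ℝ F] (T : R4 →ₗ[ℝ] R4 →ₗ[ℝ] F) :
    ∑ i, ∑ j, S.coord.ginv y i j • T (basisVec i) (basisVec j) = ∑ k, T (E k) (E k) := by
  have h : ∀ k, T (E k) (E k) = ∑ i, ∑ j, (E k i * E k j) • T (basisVec i) (basisVec j) :=
    fun k ↦ by
      conv_lhs => rw [← sum_smul_basisVec (E k)]
      simp only [map_sum, map_smul, LinearMap.sum_apply, LinearMap.smul_apply, Finset.smul_sum,
        smul_smul]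
      rw [Finset.sum_comm]
      simp only [mul_comm]
  simp only [hE.ginv_eq, h, Finset.sum_smul]
  conv_rhs => rw [Finset.sum_comm]
  exact Finset.sum_congr rfl fun i _ ↦ Finset.sum_comm

theorem tr_eq {T : R4 → R4 → ℝ} (hT : IsBilinearMap ℝ T) :
    S.coord.tr y T = ∑ k, T (E k) (E k) :=
  hE.sum_ginv_smul hT.toLinearMap

theorem sharp_eq (α : R4 →L[ℝ] ℝ) : S.coord.sharp y α = ∑ k, α (E k) • E k := by
  have h := hE.sum_ginv_smul ((LinearMap.lsmul ℝ R4).comp (α : R4 →ₗ[ℝ] ℝ))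
  simpa [sharp, smul_smul] using h

theorem inner1_eq (α β : R4 →L[ℝ] ℝ) : S.coord.inner1 y α β = ∑ k, α (E k) * β (E k) :=
  hE.tr_eq (by constructor <;> intros <;> simp <;> ring)

end IsFrame

theorem metric_J_left (hy : y ∈ S.domain) (u v : R4) :
    S.metric y (S.J y u) v = -S.metric y u (S.J y v) := by
  rw [← S.metric_J_J y hy u, S.J_J_apply y hy, map_neg, neg_neg]

theorem metric_J_self (hy : y ∈ S.domain) (u : R4) : S.metric y (S.J y u) u = 0 := by
  have h := S.metric_J_left hy u u
  rw [S.symm y hy u] at h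
  linarith

theorem exists_smul_unit (hy : y ∈ S.domain) {u : R4} (hu : u ≠ 0) :
    ∃ r : ℝ, r ≠ 0 ∧ S.metric y (r • u) (r • u) = 1 := by
  have h := S.pos y hy u hu
  have h' : √(S.metric y u u) ≠ 0 := by positivity
  refine ⟨(√(S.metric y u u))⁻¹, by positivity, ?_⟩
  simp only [map_smul, smul_apply, smul_eq_mul]
  field_simp
  rw [Real.sq_sqrt h.le]

theorem exists_ne_zero_orthogonal (y a b : R4) :
    ∃ z, z ≠ 0 ∧ S.metric y a z = 0 ∧ S.metric y b z = 0 := by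
  let L : R4 →ₗ[ℝ] ℝ × ℝ := (S.metric y a : R4 →ₗ[ℝ] ℝ).prod (S.metric y b)
  obtain ⟨z, hz, hz0⟩ : ∃ z ∈ LinearMap.ker L, z ≠ 0 :=
    (Submodule.ne_bot_iff _).1 (LinearMap.ker_ne_bot_of_finrank_lt (by simp))
  exact ⟨z, hz0, Prod.mk.inj (LinearMap.mem_ker.1 hz)⟩

theorem exists_isAdaptedFrame (hy : y ∈ S.domain) {a : R4} (ha : a ≠ 0) :
    ∃ E, S.IsAdaptedFrame y E ∧ ∃ r : ℝ, r ≠ 0 ∧ E 0 = r • a := by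
  obtain ⟨r, hr, ha1⟩ := S.exists_smul_unit hy ha
  obtain ⟨z, hz, hz1, hz2⟩ := S.exists_ne_zero_orthogonal y (r • a) (S.J y (r • a))
  obtain ⟨t, -, hb1⟩ := S.exists_smul_unit hy hz
  set e := r • a
  set f := t • z with hf
  have hef : S.metric y e f = 0 := by rw [hf, map_smul, hz1, smul_zero]
  have hJef : S.metric y (S.J y e) f = 0 := by rw [hf, map_smul, hz2, smul_zero]
  have heJf : S.metric y e (S.J y f) = 0 := by rwa [S.metric_J_left hy, neg_eq_zero] at hJef
  have he := S.metric_J_self hy e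
  have hf := S.metric_J_self hy f
  have hsymm := S.symm y hy
  refine ⟨![e, S.J y e, f, S.J y f],
    ⟨fun i j ↦ ?_, rfl, S.J_J_apply y hy e, rfl, S.J_J_apply y hy f⟩, r, hr, rfl⟩
  fin_cases i <;> fin_cases j <;>
    simp [S.metric_J_J y hy, ha1, hb1, hef, hJef, heJf, he, hf, hsymm e (S.J y e),
      hsymm f (S.J y f), hsymm f e, hsymm f (S.J y e), hsymm (S.J y f) e]

theorem exists_isFrame (hy : y ∈ S.domain) : ∃ E, S.IsFrame y E :=
  let ⟨_, hu⟩ := exists_ne (0 : R4)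
  let ⟨E, hE, _⟩ := S.exists_isAdaptedFrame hy hu
  ⟨E, hE.isFrame⟩

theorem metric_sharp (hy : y ∈ S.domain) (α : R4 →L[ℝ] ℝ) (w : R4) :
    S.metric y (S.coord.sharp y α) w = α w := by
  obtain ⟨E, hE⟩ := S.exists_isFrame hy
  rw [hE.sharp_eq]
  conv_rhs => rw [← hE.sum_metric_smul w]
  simp [mul_comm, S.symm y hy w]

theorem eq_of_metric_eq (hy : y ∈ S.domain) {u v : R4}
    (h : ∀ w, S.metric y u w = S.metric y v w) : u = v := by
  by_contra huv
  have hpos := S.pos y hy (u - v) (sub_ne_zero.2 huv)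
  simp [h] at hpos

end LocalAlmostHermitian

section Koszul

variable {E F : Type*} [NormedAddCommGroup E] [NormedSpace ℝ E] [NormedAddCommGroup F]
  [NormedSpace ℝ F]

/-- The Koszul combination `½ (T(u, v, w) + T(v, u, w) - T(w, u, v))`. For the derivative `T` of a
metric this is the Christoffel symbol of the first kind `g(∇_u v, w)`. -/
def koszul (T : E →L[ℝ] E →L[ℝ] E →L[ℝ] ℝ) : E →L[ℝ] E →L[ℝ] E →L[ℝ] ℝ :=
  (1 / 2 : ℝ) • (T + T.flip - (ContinuousLinearMap.flipₗᵢ ℝ E E ℝ : _ →L[ℝ] _) ∘L T.flip)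

theorem koszul_apply (T : E →L[ℝ] E →L[ℝ] E →L[ℝ] ℝ) (u v w : E) :
    koszul T u v w = (1 / 2) * (T u v w + T v u w - T w u v) := rfl

set_option synthInstance.maxHeartbeats 100000 in
-- Norms on threefold spaces of continuous linear maps are slow to synthesize.
theorem contDiffAt_koszul {T : F → E →L[ℝ] E →L[ℝ] E →L[ℝ] ℝ} {x : F} (hT : ContDiffAt ℝ ∞ T x) :
    ContDiffAt ℝ ∞ (fun y ↦ koszul (T y)) x := by
  have hflip : ContDiffAt ℝ ∞ (fun y ↦ (T y).flip) x :=
    (ContinuousLinearMap.flipₗᵢ ℝ E E (E →L[ℝ] ℝ)).contDiff.contDiffAt.comp x hT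
  exact ((hT.add hflip).sub (contDiffAt_const.clm_comp hflip)).const_smul _

end Koszul

namespace LocalAlmostHermitian

open Coord

variable {S : LocalAlmostHermitian} {y : R4}

/-! ### The Levi-Civita connection -/

theorem eventually_mem_domain (hy : y ∈ S.domain) : ∀ᶠ z in 𝓝 y, z ∈ S.domain :=
  S.isOpen_domain.mem_nhds hy

theorem contDiffAt_metric (hy : y ∈ S.domain) : ContDiffAt ℝ ∞ S.metric y :=
  S.contDiffOn_metric.contDiffAt (S.isOpen_domain.mem_nhds hy)

theorem contDiffAt_J (hy : y ∈ S.domain) : ContDiffAt ℝ ∞ S.J y :=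
  S.contDiffOn_J.contDiffAt (S.isOpen_domain.mem_nhds hy)

/-- The isomorphism of the tangent space with its dual given by the metric. -/
def flat (hy : y ∈ S.domain) : R4 ≃L[ℝ] R4 →L[ℝ] ℝ :=
  ContinuousLinearEquiv.ofBijective (S.metric y)
    (LinearMap.ker_eq_bot'.2 fun u hu ↦ S.eq_of_metric_eq hy fun w ↦ by
      simpa using DFunLike.congr_fun hu w)
    (LinearMap.range_eq_top.2 fun α ↦
      ⟨S.coord.sharp y α, ContinuousLinearMap.ext (S.metric_sharp hy α)⟩)

theorem coe_flat (hy : y ∈ S.domain) : (flat hy : R4 →L[ℝ] R4 →L[ℝ] ℝ) = S.metric y :=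
  ContinuousLinearEquiv.coe_ofBijective _ _ _

variable (S)

/-- The connection form of the Levi-Civita connection: `∇_u v = ∂_u v + lc y u v`. -/
def lc (y : R4) : R4 →L[ℝ] R4 →L[ℝ] R4 :=
  ContinuousLinearMap.compL ℝ R4 (R4 →L[ℝ] ℝ) R4 (S.metric y).inverse ∘L
    koszul (fderiv ℝ S.metric y)

variable {S}

theorem fderiv_metric_apply (hy : y ∈ S.domain) (u v w : R4) :
    fderiv ℝ (fun z ↦ S.metric z v w) y u = fderiv ℝ S.metric y u v w := by
  have hd := differentiableAt_of_smooth (S.contDiffAt_metric hy)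
  rw [fderiv_clm_apply_const (hd.clm_apply (differentiableAt_const v)), fderiv_clm_apply_const hd]

theorem fderiv_metric_symm (hy : y ∈ S.domain) (u v w : R4) :
    fderiv ℝ S.metric y u v w = fderiv ℝ S.metric y u w v := by
  rw [← S.fderiv_metric_apply hy, ← S.fderiv_metric_apply hy]
  refine DFunLike.congr_fun (EventuallyEq.fderiv_eq ?_) u
  filter_upwards [S.eventually_mem_domain hy] with z hz using S.symm z hz v w

theorem metric_lc (hy : y ∈ S.domain) (u v : R4) :
    S.metric y (S.lc y u v) = koszul (fderiv ℝ S.metric y) u v := by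
  have h : S.lc y u v = (S.metric y).inverse (koszul (fderiv ℝ S.metric y) u v) := rfl
  rw [h, ← S.coe_flat hy, ContinuousLinearMap.inverse_equiv]
  exact (flat hy).apply_symm_apply _

theorem christoffel_eq (hy : y ∈ S.domain) (u v : R4) :
    S.coord.christoffel y u v = S.lc y u v := by
  refine S.eq_of_metric_eq hy fun w ↦ ?_
  rw [S.metric_lc hy, ← S.metric_sharp hy (koszul (fderiv ℝ S.metric y) u v)]
  simp only [christoffel, coord_g, pd, S.fderiv_metric_apply hy]
  rfl

theorem contDiffAt_lc (hy : y ∈ S.domain) : ContDiffAt ℝ ∞ S.lc y := by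
  have hinv : ContDiffAt ℝ ∞ (fun z ↦ (S.metric z).inverse) y := by
    have h := contDiffAt_map_inverse (n := ∞) (S.flat hy)
    rw [S.coe_flat hy] at h
    exact h.comp y (S.contDiffAt_metric hy)
  have hcomp : ContDiffAt ℝ ∞
      (fun z ↦ ContinuousLinearMap.compL ℝ R4 (R4 →L[ℝ] ℝ) R4 (S.metric z).inverse) y :=
    (ContinuousLinearMap.compL ℝ R4 (R4 →L[ℝ] ℝ) R4).contDiff.contDiffAt.comp y hinv
  exact hcomp.clm_comp (contDiffAt_koszul (contDiffAt_fderiv (S.contDiffAt_metric hy)))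

theorem lc_symm (hy : y ∈ S.domain) (u v : R4) : S.lc y u v = S.lc y v u := by
  refine S.eq_of_metric_eq hy fun w ↦ ?_
  rw [S.metric_lc hy, S.metric_lc hy, koszul_apply, koszul_apply, S.fderiv_metric_symm hy w u v]
  ring

theorem fderiv_metric (hy : y ∈ S.domain) (u v w : R4) :
    fderiv ℝ S.metric y u v w = S.metric y (S.lc y u v) w + S.metric y v (S.lc y u w) := by
  rw [S.symm y hy v, S.metric_lc hy, S.metric_lc hy, koszul_apply, koszul_apply,
    S.fderiv_metric_symm hy u w v]
  ring

/-! ### Curvature -/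

theorem curvForm_lc_apply (u v w : R4) : curvForm S.lc y u v w =
    fderiv ℝ S.lc y u v w - fderiv ℝ S.lc y v u w
      + (S.lc y u (S.lc y v w) - S.lc y v (S.lc y u w)) := rfl

theorem fderiv_lc_apply (hy : y ∈ S.domain) (u v w : R4) :
    fderiv ℝ (fun z ↦ S.lc z v w) y u = fderiv ℝ S.lc y u v w := by
  have hd := differentiableAt_of_smooth (S.contDiffAt_lc hy)
  rw [fderiv_clm_apply_const (hd.clm_apply (differentiableAt_const v)), fderiv_clm_apply_const hd]

theorem curvOp_eq (hy : y ∈ S.domain) (u v w : R4) :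
    S.coord.curvOp y u v w = -curvForm S.lc y u v w := by
  have hΓ : ∀ v, (fun z ↦ S.coord.christoffel z v w) =ᶠ[𝓝 y] fun z ↦ S.lc z v w := fun v ↦ by
    filter_upwards [S.eventually_mem_domain hy] with z hz using S.christoffel_eq hz v w
  simp only [curvOp, pd, (hΓ _).fderiv_eq, S.fderiv_lc_apply hy, S.christoffel_eq hy,
    curvForm_lc_apply]
  abel

theorem curv_eq (hy : y ∈ S.domain) (u v w z : R4) :
    S.coord.curv y u v w z = -S.metric y (curvForm S.lc y u v w) z := by
  rw [curv, S.curvOp_eq hy]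
  simp

theorem fderiv_fderiv_metric_apply (hy : y ∈ S.domain) (u v w z : R4) :
    fderiv ℝ (fun t ↦ fderiv ℝ (fun s ↦ S.metric s w z) t v) y u =
      S.metric y (fderiv ℝ S.lc y u v w + S.lc y u (S.lc y v w)) z
        + S.metric y (S.lc y v w) (S.lc y u z) + S.metric y (S.lc y u w) (S.lc y v z)
        + S.metric y w (fderiv ℝ S.lc y u v z + S.lc y u (S.lc y v z)) := by
  have hG := differentiableAt_of_smooth (S.contDiffAt_metric hy)
  have hΓ : ∀ w, DifferentiableAt ℝ (fun t ↦ S.lc t v w) y := fun w ↦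
    ((differentiableAt_of_smooth (S.contDiffAt_lc hy)).clm_apply
      (differentiableAt_const v)).clm_apply (differentiableAt_const w)
  have h : (fun t ↦ fderiv ℝ (fun s ↦ S.metric s w z) t v) =ᶠ[𝓝 y]
      fun t ↦ S.metric t (S.lc t v w) z + S.metric t w (S.lc t v z) := by
    filter_upwards [S.eventually_mem_domain hy] with t ht
    rw [S.fderiv_metric_apply ht, S.fderiv_metric ht]
  have h₁ := hG.clm_apply (hΓ w)
  have h₂ := hG.clm_apply (differentiableAt_const w)
  rw [h.fderiv_eq, fderiv_fun_add (h₁.clm_apply (differentiableAt_const z)) (h₂.clm_apply (hΓ z)),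
    add_apply, fderiv_clm_apply_const h₁, fderiv_clm_apply h₂ (hΓ z), fderiv_clm_apply hG (hΓ w),
    fderiv_clm_apply hG (differentiableAt_const w)]
  simp only [add_apply, ContinuousLinearMap.comp_apply, S.fderiv_lc_apply hy,
    ContinuousLinearMap.flip_apply, S.fderiv_metric hy, fderiv_fun_const, Pi.zero_apply,
    ContinuousLinearMap.comp_zero, zero_add, map_add]
  ring

theorem metric_curvForm_skew (hy : y ∈ S.domain) (u v w z : R4) :
    S.metric y (curvForm S.lc y u v w) z = -S.metric y w (curvForm S.lc y u v z) := by
  have hf : ContDiffAt ℝ ∞ (fun s ↦ S.metric s w z) y :=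
    ((S.contDiffAt_metric hy).clm_apply contDiffAt_const).clm_apply contDiffAt_const
  have hf' := differentiableAt_of_smooth (contDiffAt_fderiv hf)
  have h := fderiv_fderiv_comm hf u v
  rw [← fderiv_clm_apply_const hf', ← fderiv_clm_apply_const hf',
    S.fderiv_fderiv_metric_apply hy, S.fderiv_fderiv_metric_apply hy] at h
  simp only [curvForm_lc_apply, map_add, map_sub, add_apply, sub_apply] at h ⊢
  linarith

theorem first_bianchi_identity (hy : y ∈ S.domain) (u v w : R4) :
    curvForm S.lc y u v w + curvForm S.lc y v w u + curvForm S.lc y w u v = 0 := by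
  have hsymm : ∀ u v w, fderiv ℝ S.lc y u v w = fderiv ℝ S.lc y u w v := fun u v w ↦ by
    rw [← S.fderiv_lc_apply hy, ← S.fderiv_lc_apply hy]
    refine DFunLike.congr_fun (EventuallyEq.fderiv_eq ?_) u
    filter_upwards [S.eventually_mem_domain hy] with t ht using S.lc_symm ht v w
  simp only [curvForm_lc_apply]
  rw [hsymm u v w, hsymm v u w, hsymm w v u, S.lc_symm hy v w, S.lc_symm hy u w, S.lc_symm hy u v]
  abel

variable {E : Fin 4 → R4}

/-! ### The covariant derivative of the almost complex structure -/

variable (S) in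
/-- The covariant derivative `∇J`, as the form `u ↦ ∇_u J` with values in endomorphisms. -/
def nablaJ (y : R4) : R4 →L[ℝ] R4 →L[ℝ] R4 := covD S.lc S.J y

theorem J_mul_J (hy : y ∈ S.domain) : S.J y * S.J y = -1 :=
  ContinuousLinearMap.ext (S.J_J_apply y hy)

theorem eventually_contDiffAt_J (hy : y ∈ S.domain) : ∀ᶠ z in 𝓝 y, ContDiffAt ℝ ∞ S.J z :=
  (S.eventually_mem_domain hy).mono fun _ ↦ S.contDiffAt_J

theorem eventually_contDiffAt_lc (hy : y ∈ S.domain) : ∀ᶠ z in 𝓝 y, ContDiffAt ℝ ∞ S.lc z :=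
  (S.eventually_mem_domain hy).mono fun _ ↦ S.contDiffAt_lc

theorem eventually_J_mul_J (hy : y ∈ S.domain) : ∀ᶠ z in 𝓝 y, S.J z * S.J z = -1 :=
  (S.eventually_mem_domain hy).mono fun _ ↦ S.J_mul_J

theorem contDiffAt_nablaJ (hy : y ∈ S.domain) : ContDiffAt ℝ ∞ S.nablaJ y :=
  contDiffAt_covD (S.contDiffAt_lc hy) (S.contDiffAt_J hy)

theorem fderiv_metric_endomorphism (hy : y ∈ S.domain) {A : R4 → R4 →L[ℝ] R4}
    (hA : DifferentiableAt ℝ A y) (u a b : R4) :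
    fderiv ℝ (fun z ↦ S.metric z (A z a) b) y u = S.metric y (covD S.lc A y u a) b
      + S.metric y (A y (S.lc y u a)) b + S.metric y (A y a) (S.lc y u b) := by
  have hG := differentiableAt_of_smooth (S.contDiffAt_metric hy)
  have hAa := hA.clm_apply (differentiableAt_const a)
  rw [fderiv_clm_apply_const (hG.clm_apply hAa), fderiv_clm_apply hG hAa]
  simp only [add_apply, ContinuousLinearMap.comp_apply, ContinuousLinearMap.flip_apply,
    fderiv_clm_apply_const hA, S.fderiv_metric hy, covD_apply, Ring.lie_def, sub_apply,
    mul_apply_eq_comp, map_add, map_sub]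
  ring

theorem metric_covD_skew (hy : y ∈ S.domain) {A : R4 → R4 →L[ℝ] R4}
    (hA : DifferentiableAt ℝ A y)
    (hskew : ∀ z ∈ S.domain, ∀ a b, S.metric z (A z a) b = -S.metric z a (A z b)) (u a b : R4) :
    S.metric y (covD S.lc A y u a) b = -S.metric y a (covD S.lc A y u b) := by
  have h : fderiv ℝ (fun z ↦ S.metric z (A z a) b) y u
      = -fderiv ℝ (fun z ↦ S.metric z (A z b) a) y u := by
    rw [← neg_apply, ← fderiv_fun_neg]
    refine DFunLike.congr_fun (EventuallyEq.fderiv_eq ?_) u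
    filter_upwards [S.eventually_mem_domain hy] with z hz
    rw [hskew z hz, S.symm z hz]
  rw [S.fderiv_metric_endomorphism hy hA, S.fderiv_metric_endomorphism hy hA,
    hskew y hy (S.lc y u a), hskew y hy (S.lc y u b), S.symm y hy (A y b), S.symm y hy (A y a),
    S.symm y hy _ a] at h
  linarith

theorem nablaJ_skew (hy : y ∈ S.domain) (u a b : R4) :
    S.metric y (S.nablaJ y u a) b = -S.metric y a (S.nablaJ y u b) :=
  S.metric_covD_skew hy (differentiableAt_of_smooth (S.contDiffAt_J hy))
    (fun _ ↦ S.metric_J_left) u a b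

theorem nablaJ_mul_J (hy : y ∈ S.domain) (u : R4) :
    S.nablaJ y u * S.J y = -(S.J y * S.nablaJ y u) :=
  covD_mul_of_sq_eq_neg_one (differentiableAt_of_smooth (S.contDiffAt_J hy))
    (S.eventually_J_mul_J hy) u

theorem nabla2_omega (hy : y ∈ S.domain) (u v w : R4) :
    S.coord.nabla2 y S.coord.omega u v w = S.metric y (S.nablaJ y u v) w := by
  have h := S.fderiv_metric_endomorphism hy (differentiableAt_of_smooth (S.contDiffAt_J hy)) u v w
  simp only [nabla2, S.christoffel_eq hy, omega, coord_g, coord_J, pd, h, nablaJ]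
  ring

theorem fderiv_J_apply (hy : y ∈ S.domain) (u v : R4) : fderiv ℝ (fun z ↦ S.J z v) y u =
    S.nablaJ y u v - S.lc y u (S.J y v) + S.J y (S.lc y u v) := by
  rw [fderiv_clm_apply_const (differentiableAt_of_smooth (S.contDiffAt_J hy))]
  simp only [nablaJ, covD_apply, Ring.lie_def, add_apply, sub_apply, mul_apply_eq_comp]
  abel

theorem nij_eq (hy : y ∈ S.domain) (u v : R4) : S.coord.nij y u v =
    S.nablaJ y (S.J y u) v - S.nablaJ y (S.J y v) u - S.J y (S.nablaJ y u v)
      + S.J y (S.nablaJ y v u) := by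
  simp only [nij, VectorField.lieBracket, coord_J, S.fderiv_J_apply hy, fderiv_fun_const,
    Pi.zero_apply, zero_apply, map_sub, map_add, map_zero, S.J_J_apply y hy]
  rw [S.lc_symm hy (S.J y v) (S.J y u), S.lc_symm hy u (S.J y v), S.lc_symm hy v (S.J y u),
    S.lc_symm hy u v]
  abel

namespace IsFrame

variable (hE : S.IsFrame y E)

include hE

theorem sum_metric_mul_metric (a b : R4) :
    ∑ k, S.metric y a (E k) * S.metric y b (E k) = S.metric y a b := by
  conv_rhs => rw [← hE.sum_metric_smul b]
  simp [mul_comm]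

theorem inner2_eq {α β : R4 → R4 → ℝ} (hα : IsBilinearMap ℝ α) (hβ : IsBilinearMap ℝ β) :
    S.coord.inner2 y α β = (1 / 2) * ∑ k, ∑ l, α (E k) (E l) * β (E k) (E l) := by
  have h : ∀ u u', S.coord.tr y (fun v v' ↦ α u v * β u' v') = ∑ l, α u (E l) * β u' (E l) :=
    fun u u' ↦ hE.tr_eq (by
      constructor <;> intros <;>
        simp only [hα.add_right, hα.smul_right, hβ.add_right, hβ.smul_right, smul_eq_mul] <;> ring)
  simp only [inner2, h]
  rw [hE.tr_eq]
  constructor <;> intros <;>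
    simp only [hα.add_left, hα.smul_left, hβ.add_left, hβ.smul_left, smul_eq_mul, add_mul, mul_add,
      Finset.sum_add_distrib, Finset.mul_sum, mul_assoc, mul_left_comm]

end IsFrame

theorem rhoStar_eq (hy : y ∈ S.domain) (u v : R4) :
    S.coord.rhoStar y u v = (1 / 2) * traceCLM (S.J y * curvForm S.lc y u v) := by
  obtain ⟨E, hE⟩ := S.exists_isFrame hy
  rw [rhoStar, hE.inner2_eq, hE.traceCLM_eq]
  · simp only [omega, coord_g, coord_J, S.curv_eq hy, neg_mul, Finset.sum_neg_distrib,
      hE.sum_metric_mul_metric, mul_apply_eq_comp]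
    simp only [S.metric_J_left hy, Finset.sum_neg_distrib]
  · constructor <;> intros <;> simp [S.curv_eq hy] <;> ring
  · constructor <;> intros <;> simp [omega]

theorem Phi_eq (hy : y ∈ S.domain) (u v : R4) : S.coord.Phi y u v =
    (1 / 4) * traceCLM (S.J y * (S.nablaJ y v * S.nablaJ y u)) := by
  obtain ⟨E, hE⟩ := S.exists_isFrame hy
  rw [Phi, hE.inner2_eq, traceCLM_mul_comm, hE.traceCLM_eq]
  · simp only [S.nabla2_omega hy, neg_mul, Finset.sum_neg_distrib, hE.sum_metric_mul_metric,
      mul_apply_eq_comp, S.nablaJ_skew hy v (S.nablaJ y u _), coord_J]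
    ring
  · constructor <;> intros <;> simp [S.nabla2_omega hy] <;> ring
  · constructor <;> intros <;> simp [S.nabla2_omega hy]

theorem lee_eq (hy : y ∈ S.domain) (v : R4) :
    S.coord.lee y v = -traceCLM ((S.nablaJ y).flip (S.J y v)) := by
  obtain ⟨E, hE⟩ := S.exists_isFrame hy
  rw [lee, Jform, delta2, hE.tr_eq, hE.traceCLM_eq]
  · simp only [coord_J, S.nabla2_omega hy, S.nablaJ_skew hy _ (E _), Finset.sum_neg_distrib,
      S.symm y hy (E _), ContinuousLinearMap.flip_apply, neg_neg]
  · constructor <;> intros <;> simp [S.nabla2_omega hy]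

/-! ### Closedness of the star-Ricci form and of `Φ` -/

variable (S) in
/-- Gray's first identity `R_{XYZW} = R_{XYJZJW}`, in the form that curvature endomorphisms
commute with `J`. -/
def IsAH1 : Prop := ∀ y ∈ S.domain, ∀ u v, ⁅curvForm S.lc y u v, S.J y⁆ = 0

theorem isAH1_of_curv_eq (h : ∀ y ∈ S.domain, ∀ u v w z,
    S.coord.curv y u v w z = S.coord.curv y u v (S.coord.J y w) (S.coord.J y z)) : S.IsAH1 := by
  intro y hy u v
  rw [Ring.lie_def, sub_eq_zero]
  ext1 a
  refine S.eq_of_metric_eq hy fun b ↦ ?_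
  have h₁ := h y hy u v a (S.J y b)
  rw [S.curv_eq hy, S.curv_eq hy] at h₁
  simp only [coord_J, S.J_J_apply y hy, map_neg, neg_neg] at h₁
  rw [mul_apply_eq_comp, mul_apply_eq_comp, S.metric_J_left hy, h₁]

theorem extd_eq_mul {β γ : R4 → R4 → R4 → ℝ} {r : ℝ}
    (h : ∀ᶠ z in 𝓝 y, ∀ u v, β z u v = r * γ z u v) (u v w : R4) :
    extd β y u v w = r * extd γ y u v w := by
  have hp : ∀ u v w, pd w (fun z ↦ β z u v) y = r * pd w (fun z ↦ γ z u v) y := fun u v w ↦ by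
    have hβ : (fun z ↦ β z u v) =ᶠ[𝓝 y] r • fun z ↦ γ z u v := h.mono fun z hz ↦ hz u v
    rw [pd, hβ.fderiv_eq, fderiv_const_smul_field]
    rfl
  simp only [extd, hp]
  ring

theorem extd_rhoStar (hS : S.IsAH1) (hy : y ∈ S.domain) (u v w : R4) :
    extd S.coord.rhoStar y u v w = 0 := by
  rw [extd_eq_mul ((S.eventually_mem_domain hy).mono fun _ ↦ S.rhoStar_eq),
    extd_trace_curvForm traceCLM_mul_comm (S.contDiffAt_lc hy) (S.contDiffAt_J hy)
      (S.eventually_J_mul_J hy) (hS y hy), mul_zero]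

theorem extd_Phi (hS : S.IsAH1) (hy : y ∈ S.domain) (u v w : R4) :
    extd S.coord.Phi y u v w = 0 := by
  rw [extd_eq_mul ((S.eventually_mem_domain hy).mono fun _ ↦ S.Phi_eq)]
  simp only [nablaJ]
  rw [extd_trace_covD traceCLM_mul_comm (S.contDiffAt_lc hy) (S.eventually_contDiffAt_J hy)
      (S.eventually_J_mul_J hy) (hS y hy), mul_zero]

/-! ### The codifferential of the Lee form -/

variable (S) in
/-- The second covariant derivative `∇²J`, as the bilinear form `(w, u) ↦ ∇²_{w,u} J`. -/
def nablaSqJ (y : R4) : R4 →L[ℝ] R4 →L[ℝ] R4 →L[ℝ] R4 :=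
  let mul := ContinuousLinearMap.mul ℝ (R4 →L[ℝ] R4)
  fderiv ℝ S.nablaJ y
    + (ContinuousLinearMap.compL ℝ R4 _ _).flip (S.nablaJ y) ∘L (mul - mul.flip) ∘L S.lc y
    - ContinuousLinearMap.compL ℝ R4 R4 _ (S.nablaJ y) ∘L S.lc y

theorem nablaSqJ_apply (hy : y ∈ S.domain) (w u : R4) : S.nablaSqJ y w u =
    covD S.lc (fun z ↦ S.nablaJ z u) y w - S.nablaJ y (S.lc y w u) := by
  rw [covD_apply, fderiv_clm_apply_const (differentiableAt_of_smooth (S.contDiffAt_nablaJ hy))]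
  rfl

theorem nablaSqJ_symm (hS : S.IsAH1) (hy : y ∈ S.domain) (w u : R4) :
    S.nablaSqJ y w u = S.nablaSqJ y u w := by
  have h := covD_covD_comm (S.contDiffAt_lc hy) (S.contDiffAt_J hy) (hS y hy w u)
  rw [S.nablaSqJ_apply hy, S.nablaSqJ_apply hy, S.lc_symm hy w u]
  simp only [nablaJ, h]

theorem nablaSqJ_skew (hy : y ∈ S.domain) (w u a b : R4) :
    S.metric y (S.nablaSqJ y w u a) b = -S.metric y a (S.nablaSqJ y w u b) := by
  have hK := (differentiableAt_of_smooth (S.contDiffAt_nablaJ hy)).clm_apply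
    (differentiableAt_const u)
  have h₁ := S.metric_covD_skew hy hK (fun z hz ↦ S.nablaJ_skew hz u) w a b
  have h₂ := S.nablaJ_skew hy (S.lc y w u) a b
  simp only [S.nablaSqJ_apply hy, sub_apply, map_sub]
  linarith

theorem nablaSqJ_mul_J (hy : y ∈ S.domain) (w u : R4) :
    S.nablaSqJ y w u * S.J y + S.J y * S.nablaSqJ y w u =
      -(S.nablaJ y u * S.nablaJ y w + S.nablaJ y w * S.nablaJ y u) := by
  have h := covD_covD_mul_of_sq_eq_neg_one (S.contDiffAt_lc hy) (S.eventually_contDiffAt_J hy)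
    (S.eventually_J_mul_J hy) w u
  rw [S.nablaSqJ_apply hy, sub_mul, mul_sub, S.nablaJ_mul_J hy, sub_neg_eq_add,
    add_add_sub_cancel]
  exact h

theorem differentiableAt_flip_nablaJ_J (hy : y ∈ S.domain) (v : R4) :
    DifferentiableAt ℝ (fun z ↦ (S.nablaJ z).flip (S.J z v)) y :=
  ((ContinuousLinearMap.flipₗᵢ ℝ R4 R4 R4).differentiableAt.comp y
    (differentiableAt_of_smooth (S.contDiffAt_nablaJ hy))).clm_apply
    ((differentiableAt_of_smooth (S.contDiffAt_J hy)).clm_apply (differentiableAt_const v))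

theorem covD_flip_nablaJ_J (hy : y ∈ S.domain) (v w : R4) :
    covD S.lc (fun z ↦ (S.nablaJ z).flip (S.J z v)) y w =
      (S.nablaSqJ y w).flip (S.J y v) + (S.nablaJ y).flip (S.nablaJ y w v)
        + (S.nablaJ y).flip (S.J y (S.lc y w v)) := by
  have dK := differentiableAt_of_smooth (S.contDiffAt_nablaJ hy)
  have dJ := (differentiableAt_of_smooth (S.contDiffAt_J hy)).clm_apply (differentiableAt_const v)
  ext1 u
  have dKu := dK.clm_apply (differentiableAt_const u)
  rw [covD_apply, add_apply, ← fderiv_clm_apply_const (S.differentiableAt_flip_nablaJ_J hy v)]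
  simp only [ContinuousLinearMap.flip_apply]
  rw [fderiv_clm_apply dKu dJ]
  simp only [add_apply, ContinuousLinearMap.comp_apply, ContinuousLinearMap.flip_apply,
    S.fderiv_J_apply hy, S.nablaSqJ_apply hy, sub_apply, covD_apply, Ring.lie_def,
    mul_apply_eq_comp, map_add, map_sub]
  abel

theorem nabla1_lee (hy : y ∈ S.domain) (w v : R4) :
    S.coord.nabla1 y S.coord.lee w v =
      -traceCLM ((S.nablaSqJ y w).flip (S.J y v) + (S.nablaJ y).flip (S.nablaJ y w v)) := by
  have hlee : (fun z ↦ S.coord.lee z v) =ᶠ[𝓝 y]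
      fun z ↦ -traceCLM ((S.nablaJ z).flip (S.J z v)) :=
    (S.eventually_mem_domain hy).mono fun z hz ↦ S.lee_eq hz v
  rw [nabla1, pd, hlee.fderiv_eq, fderiv_fun_neg, neg_apply,
    fderiv_trace (Γ := S.lc) traceCLM_mul_comm (S.differentiableAt_flip_nablaJ_J hy v),
    S.covD_flip_nablaJ_J hy, S.christoffel_eq hy, S.lee_eq hy, map_add _ (_ + _)]
  ring

/-- Since `∇²J` is symmetric in its two directions and skew-adjoint, the second derivatives enter
`δθ` only through `∇²J ∘ J + J ∘ ∇²J`, which is quadratic in `∇J`. -/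
theorem delta1_lee (hS : S.IsAH1) (hy : y ∈ S.domain) (hE : S.IsFrame y E) :
    S.coord.delta1 y S.coord.lee = (1 / 2) * ∑ l, ∑ k,
      S.metric y (⁅S.nablaJ y (E k), S.nablaJ y (E l)⁆ (E l)) (E k) := by
  have hsum : ∑ l, ∑ k, S.metric y (S.nablaSqJ y (E l) (E k) (S.J y (E l))) (E k)
      = ∑ l, ∑ k, S.metric y (S.J y (S.nablaSqJ y (E l) (E k) (E l))) (E k) := by
    rw [Finset.sum_comm]
    refine Finset.sum_congr rfl fun l _ ↦ Finset.sum_congr rfl fun k _ ↦ ?_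
    rw [S.nablaSqJ_symm hS hy, S.nablaSqJ_skew hy, S.metric_J_left hy, neg_neg,
      S.symm y hy]
  have hJ : ∀ l k, S.metric y (S.nablaSqJ y (E l) (E k) (S.J y (E l))) (E k)
      + S.metric y (S.J y (S.nablaSqJ y (E l) (E k) (E l))) (E k)
      = -(S.metric y (S.nablaJ y (E k) (S.nablaJ y (E l) (E l))) (E k)
        + S.metric y (S.nablaJ y (E l) (S.nablaJ y (E k) (E l))) (E k)) := fun l k ↦ by
    have h := congrArg (fun L : R4 →L[ℝ] R4 ↦ S.metric y (L (E l)) (E k))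
      (S.nablaSqJ_mul_J hy (E l) (E k))
    simpa only [add_apply, neg_apply, mul_apply_eq_comp, map_add, map_neg] using h
  have hJsum := Finset.sum_congr rfl fun l (_ : l ∈ Finset.univ) ↦
    Finset.sum_congr rfl fun k (_ : k ∈ Finset.univ) ↦ hJ l k
  rw [delta1, hE.tr_eq]
  · simp only [S.nabla1_lee hy, hE.traceCLM_eq, Ring.lie_def, add_apply, sub_apply,
      mul_apply_eq_comp, ContinuousLinearMap.flip_apply, map_add, map_sub, Finset.sum_neg_distrib,
      Finset.sum_add_distrib, Finset.sum_sub_distrib, neg_neg] at hJsum ⊢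
    linarith
  · constructor <;> intros <;> simp [S.nabla1_lee hy] <;> ring

end LocalAlmostHermitian

/-! ### The Ricci tensor -/

theorem isBilinearMap_curvForm {E 𝔸 : Type*} [NormedAddCommGroup E] [NormedSpace ℝ E]
    [NormedRing 𝔸] [NormedAlgebra ℝ 𝔸] (Γ : E → E →L[ℝ] 𝔸) (x : E) :
    IsBilinearMap ℝ (curvForm Γ x) := by
  constructor <;> intros <;>
    simp only [curvForm, Ring.lie_def, map_add, map_smul, add_apply, smul_apply, add_mul, mul_add,
      smul_mul_assoc, mul_smul_comm, smul_add, smul_sub] <;> abel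

theorem pair_symm_of_cyclic {V : Type*} {R : V → V → V → V → ℝ}
    (h₁₂ : ∀ u v w z, R u v w z = -R v u w z) (h₃₄ : ∀ u v w z, R u v w z = -R u v z w)
    (h : ∀ u v w z, R u v w z + R v w u z + R w u v z = 0) (u v w z : V) :
    R u v w z = R w z u v := by
  linarith [h u v w z, h v w z u, h w z u v, h z u v w, h₃₄ u v w z, h₃₄ v w u z, h₁₂ w u v z,
    h₃₄ u w v z, h₃₄ w z u v, h₁₂ z v w u, h₃₄ v z w u, h₃₄ z u w v]

namespace LocalAlmostHermitian

open Coord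

variable {S : LocalAlmostHermitian} {y : R4} {E : Fin 4 → R4}

theorem metric_curvForm_pair_symm (hy : y ∈ S.domain) (u v w z : R4) :
    S.metric y (curvForm S.lc y u v w) z = S.metric y (curvForm S.lc y w z u) v := by
  refine pair_symm_of_cyclic (R := fun u v w z ↦ S.metric y (curvForm S.lc y u v w) z)
    (fun u v w z ↦ ?_) (fun u v w z ↦ ?_) (fun u v w z ↦ ?_) u v w z
  · rw [curvForm_antisymm, neg_apply, map_neg, neg_apply]
  · rw [S.metric_curvForm_skew hy, S.symm y hy]
  · rw [← add_apply, ← map_add, ← add_apply, ← map_add, S.first_bianchi_identity hy, map_zero,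
      zero_apply]

theorem ricci_eq (hy : y ∈ S.domain) (hE : S.IsFrame y E) (u v : R4) :
    S.coord.ricci y u v = -∑ k, S.metric y (curvForm S.lc y u (E k) v) (E k) := by
  have hR := isBilinearMap_curvForm S.lc y
  rw [ricci, hE.tr_eq]
  · simp only [S.curv_eq hy, Finset.sum_neg_distrib]
  · constructor <;> intros <;> simp [S.curv_eq hy, hR.add_right, hR.smul_right] <;> ring

theorem isBilinearMap_ricci (hy : y ∈ S.domain) : IsBilinearMap ℝ (S.coord.ricci y) := by
  obtain ⟨E, hE⟩ := S.exists_isFrame hy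
  have hR := isBilinearMap_curvForm S.lc y
  constructor <;> intros <;>
    simp [S.ricci_eq hy hE, hR.add_left, hR.smul_left, Finset.sum_add_distrib, Finset.mul_sum] <;>
    ring

theorem ricci_symm (hy : y ∈ S.domain) (u v : R4) :
    S.coord.ricci y u v = S.coord.ricci y v u := by
  obtain ⟨E, hE⟩ := S.exists_isFrame hy
  simp only [S.ricci_eq hy hE, S.metric_curvForm_pair_symm hy u]

theorem metric_curvForm_J_J (hS : S.IsAH1) (hy : y ∈ S.domain) (u v w z : R4) :
    S.metric y (curvForm S.lc y u v (S.J y w)) (S.J y z) =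
      S.metric y (curvForm S.lc y u v w) z := by
  have h : curvForm S.lc y u v (S.J y w) = S.J y (curvForm S.lc y u v w) :=
    DFunLike.congr_fun (sub_eq_zero.1 (hS y hy u v)) w
  rw [h, S.metric_J_J y hy]

theorem IsFrame.J_comp (hy : y ∈ S.domain) (hE : S.IsFrame y E) :
    S.IsFrame y fun k ↦ S.J y (E k) :=
  fun i j ↦ by rw [S.metric_J_J y hy, hE i j]

theorem ricci_J_J (hS : S.IsAH1) (hy : y ∈ S.domain) (u v : R4) :
    S.coord.ricci y (S.J y u) (S.J y v) = S.coord.ricci y u v := by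
  obtain ⟨E, hE⟩ := S.exists_isFrame hy
  rw [S.ricci_eq hy (hE.J_comp hy), S.ricci_eq hy hE]
  congr! 2 with k
  rw [S.metric_curvForm_J_J hS hy, S.metric_curvForm_pair_symm hy, S.metric_curvForm_J_J hS hy,
    S.metric_curvForm_pair_symm hy]

theorem ricci_J_left (hS : S.IsAH1) (hy : y ∈ S.domain) (u v : R4) :
    S.coord.ricci y (S.J y u) v = -S.coord.ricci y u (S.J y v) := by
  rw [← S.ricci_J_J hS hy u, S.J_J_apply y hy, ← neg_one_smul ℝ v,
    (S.isBilinearMap_ricci hy).smul_right, neg_one_smul, neg_neg]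

theorem rho_eq (hS : S.IsAH1) (hy : y ∈ S.domain) (u v : R4) :
    S.coord.rho y u v = S.coord.ricci y (S.J y u) v := by
  simp only [rho, coord_J, S.ricci_J_J hS hy]
  ring

theorem rhoStar_eq_sum (hy : y ∈ S.domain) (hE : S.IsFrame y E) (u v : R4) :
    S.coord.rhoStar y u v =
      -(1 / 2) * ∑ k, S.metric y (curvForm S.lc y u v (E k)) (S.J y (E k)) := by
  rw [S.rhoStar_eq hy, hE.traceCLM_eq]
  simp only [mul_apply_eq_comp, S.metric_J_left hy, Finset.sum_neg_distrib]
  ring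

theorem rhoStar_eq_rho (hS : S.IsAH1) (hy : y ∈ S.domain) (u v : R4) :
    S.coord.rhoStar y u v = S.coord.rho y u v := by
  obtain ⟨E, hE⟩ := S.exists_isFrame hy
  have hJ : ∀ u v k, S.metric y (curvForm S.lc y u (E k) v) (S.J y (E k))
      = -S.metric y (curvForm S.lc y u (E k) (S.J y v)) (E k) := fun u v k ↦ by
    rw [← S.metric_curvForm_J_J hS hy, S.J_J_apply y hy, map_neg]
  have hcyclic : ∀ k, S.metric y (curvForm S.lc y u v (E k)) (S.J y (E k))
      = S.metric y (curvForm S.lc y v (E k) (S.J y u)) (E k)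
        - S.metric y (curvForm S.lc y u (E k) (S.J y v)) (E k) := fun k ↦ by
    have h := congrArg (fun a ↦ S.metric y a (S.J y (E k))) (S.first_bianchi_identity hy u v (E k))
    rw [curvForm_antisymm (E k) u] at h
    simp only [map_add, map_zero, map_neg, add_apply, neg_apply, zero_apply, hJ] at h
    linarith
  have h := S.ricci_J_left hS hy u v
  have h' := S.ricci_symm hy v (S.J y u)
  rw [S.rhoStar_eq_sum hy hE, S.rho_eq hS hy]
  rw [S.ricci_eq hy hE v] at h'
  rw [S.ricci_eq hy hE u] at h
  simp only [hcyclic, Finset.sum_sub_distrib]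
  linarith

theorem extd_rho (hS : S.IsAH1) (hy : y ∈ S.domain) (u v w : R4) :
    extd S.coord.rho y u v w = 0 := by
  have h : ∀ᶠ z in 𝓝 y, ∀ u v, S.coord.rho z u v = 1 * S.coord.rhoStar z u v :=
    (S.eventually_mem_domain hy).mono fun z hz u v ↦ by rw [one_mul, S.rhoStar_eq_rho hS hz]
  rw [extd_eq_mul h, S.extd_rhoStar hS hy, mul_zero]

/-! ### Skew-adjoint antilinear endomorphisms -/

variable (S) in
/-- Skew-adjoint endomorphisms of the tangent space at `y` which anticommute with `J`; in
dimension four they form a complex line, and `∇_u J` belongs to it. -/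
structure IsSkewAntilinear (y : R4) (K : R4 →L[ℝ] R4) : Prop where
  skew : ∀ a b, S.metric y (K a) b = -S.metric y a (K b)
  mul_J : K * S.J y = -(S.J y * K)

theorem isSkewAntilinear_nablaJ (hy : y ∈ S.domain) (u : R4) :
    S.IsSkewAntilinear y (S.nablaJ y u) :=
  ⟨S.nablaJ_skew hy u, S.nablaJ_mul_J hy u⟩

namespace IsSkewAntilinear

variable {K A : R4 →L[ℝ] R4}

theorem apply_J (hK : S.IsSkewAntilinear y K) (a : R4) : K (S.J y a) = -S.J y (K a) :=
  DFunLike.congr_fun hK.mul_J a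

theorem J_mul (hy : y ∈ S.domain) (hK : S.IsSkewAntilinear y K) :
    S.IsSkewAntilinear y (S.J y * K) where
  skew a b := by
    rw [mul_apply_eq_comp, mul_apply_eq_comp, S.metric_J_left hy, hK.skew, hK.apply_J, map_neg,
      neg_neg]
  mul_J := by rw [mul_assoc, hK.mul_J, mul_neg]

theorem smul (hK : S.IsSkewAntilinear y K) (r : ℝ) : S.IsSkewAntilinear y (r • K) where
  skew a b := by simp [hK.skew a b]
  mul_J := by rw [smul_mul_assoc, hK.mul_J, mul_smul_comm, smul_neg]

theorem lie (hK : S.IsSkewAntilinear y K)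
    (hA : ∀ a b, S.metric y (A a) b = -S.metric y a (A b)) (hAJ : ⁅A, S.J y⁆ = 0) :
    S.IsSkewAntilinear y ⁅A, K⁆ where
  skew a b := by
    simp only [Ring.lie_def, sub_apply, mul_apply_eq_comp, map_sub, hA, hK.skew]
    ring
  mul_J := by
    rw [Ring.lie_def, sub_eq_zero] at hAJ
    rw [Ring.lie_def, sub_mul, mul_sub, mul_assoc, hK.mul_J, mul_assoc, hAJ, mul_neg, ← mul_assoc,
      hAJ, ← mul_assoc, hK.mul_J, neg_mul, mul_assoc, mul_assoc]
    abel

theorem metric_self (hK : S.IsSkewAntilinear y K) (hy : y ∈ S.domain) (a : R4) :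
    S.metric y (K a) a = 0 := by
  have h := hK.skew a a
  rw [S.symm y hy a] at h
  linarith

theorem metric_apply_J_self (hK : S.IsSkewAntilinear y K) (hy : y ∈ S.domain) (a : R4) :
    S.metric y (K a) (S.J y a) = 0 := by
  have h := (hK.J_mul hy).metric_self hy a
  rwa [mul_apply_eq_comp, S.metric_J_left hy, neg_eq_zero] at h

end IsSkewAntilinear

namespace IsAdaptedFrame

variable (hE : S.IsAdaptedFrame y E) {K L A : R4 →L[ℝ] R4}

include hE

theorem J_apply (u : R4) : S.J y u = -S.metric y u (E 1) • E 0 + S.metric y u (E 0) • E 1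
    - S.metric y u (E 3) • E 2 + S.metric y u (E 2) • E 3 := by
  conv_lhs => rw [← hE.isFrame.sum_metric_smul u]
  simp only [Fin.sum_univ_four, map_add, map_smul, hE.J_zero, hE.J_one, hE.J_two, hE.J_three]
  module

theorem exists_skewAntilinear_eq (hy : y ∈ S.domain) (hK : S.IsSkewAntilinear y K) : ∃ m n : ℝ,
    K (E 0) = m • E 2 + n • E 3 ∧ K (E 1) = n • E 2 - m • E 3 ∧
      K (E 2) = -m • E 0 - n • E 1 ∧ K (E 3) = -n • E 0 + m • E 1 := by
  obtain ⟨m, hm⟩ : ∃ m, m = S.metric y (K (E 0)) (E 2) := ⟨_, rfl⟩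
  obtain ⟨n, hn⟩ : ∃ n, n = S.metric y (K (E 0)) (E 3) := ⟨_, rfl⟩
  have h₀₁ := hK.metric_apply_J_self hy (E 0)
  have h₂₃ := hK.metric_apply_J_self hy (E 2)
  rw [hE.J_zero] at h₀₁
  rw [hE.J_two] at h₂₃
  have hK₀ : K (E 0) = m • E 2 + n • E 3 := by
    rw [← hE.isFrame.sum_metric_smul (K (E 0)), Fin.sum_univ_four, hK.metric_self hy, h₀₁, hm, hn]
    module
  have hK₁ : K (E 1) = n • E 2 - m • E 3 := by
    rw [← hE.J_zero, hK.apply_J, hK₀, map_add, map_smul, map_smul, hE.J_two, hE.J_three]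
    module
  have h₂₁ : S.metric y (K (E 2)) (E 1) = -n := by
    simp [hK.skew, hK₁, hE.isFrame _ _]
  have hK₂ : K (E 2) = -m • E 0 - n • E 1 := by
    rw [← hE.isFrame.sum_metric_smul (K (E 2)), Fin.sum_univ_four, hK.metric_self hy, h₂₃, h₂₁,
      hK.skew, S.symm y hy, hm]
    module
  refine ⟨m, n, hK₀, hK₁, hK₂, ?_⟩
  rw [← hE.J_two, hK.apply_J, hK₂, map_sub, map_smul, map_smul, hE.J_zero, hE.J_one]
  module

theorem skewAntilinear_ext (hy : y ∈ S.domain) (hK : S.IsSkewAntilinear y K)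
    (hL : S.IsSkewAntilinear y L) (h : K (E 0) = L (E 0)) : K = L := by
  obtain ⟨m, n, hK₀, hK₁, hK₂, hK₃⟩ := hE.exists_skewAntilinear_eq hy hK
  obtain ⟨m', n', hL₀, hL₁, hL₂, hL₃⟩ := hE.exists_skewAntilinear_eq hy hL
  rw [hK₀, hL₀] at h
  obtain rfl : m = m' := by
    simpa [hE.isFrame _ _] using congrArg (fun a ↦ S.metric y a (E 2)) h
  obtain rfl : n = n' := by
    simpa [hE.isFrame _ _] using congrArg (fun a ↦ S.metric y a (E 3)) h
  refine ContinuousLinearMap.coe_injective (hE.isFrame.basis.ext fun k ↦ ?_)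
  rw [hE.isFrame.coe_basis]
  fin_cases k
  exacts [hK₀.trans hL₀.symm, hK₁.trans hL₁.symm, hK₂.trans hL₂.symm, hK₃.trans hL₃.symm]

theorem exists_skewLinear_eq (hy : y ∈ S.domain)
    (hA : ∀ a b, S.metric y (A a) b = -S.metric y a (A b)) (hAJ : ⁅A, S.J y⁆ = 0) :
    ∃ a b c d : ℝ, A (E 0) = a • E 1 + b • E 2 + c • E 3 ∧
      A (E 1) = -a • E 0 - c • E 2 + b • E 3 ∧ A (E 2) = -b • E 0 + c • E 1 + d • E 3 ∧
      A (E 3) = -c • E 0 - b • E 1 - d • E 2 := by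
  have hcomm : ∀ v, A (S.J y v) = S.J y (A v) := DFunLike.congr_fun (sub_eq_zero.1 hAJ)
  have hself : ∀ v, S.metric y (A v) v = 0 := fun v ↦ by
    have h := hA v v
    rw [S.symm y hy v] at h
    linarith
  obtain ⟨a, ha⟩ : ∃ a, a = S.metric y (A (E 0)) (E 1) := ⟨_, rfl⟩
  obtain ⟨b, hb⟩ : ∃ b, b = S.metric y (A (E 0)) (E 2) := ⟨_, rfl⟩
  obtain ⟨c, hc⟩ : ∃ c, c = S.metric y (A (E 0)) (E 3) := ⟨_, rfl⟩
  obtain ⟨d, hd⟩ : ∃ d, d = S.metric y (A (E 2)) (E 3) := ⟨_, rfl⟩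
  have hA₀ : A (E 0) = a • E 1 + b • E 2 + c • E 3 := by
    rw [← hE.isFrame.sum_metric_smul (A (E 0)), Fin.sum_univ_four, hself, ha, hb, hc]
    module
  have hA₁ : A (E 1) = -a • E 0 - c • E 2 + b • E 3 := by
    rw [← hE.J_zero, hcomm, hA₀]
    simp only [map_add, map_smul, hE.J_one, hE.J_two, hE.J_three]
    module
  have h₂₁ : S.metric y (A (E 2)) (E 1) = c := by
    simp [hA, hA₁, hE.isFrame _ _]
  have hA₂ : A (E 2) = -b • E 0 + c • E 1 + d • E 3 := by
    rw [← hE.isFrame.sum_metric_smul (A (E 2)), Fin.sum_univ_four, hself, h₂₁, hA, S.symm y hy,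
      ← hb, ← hd]
    module
  refine ⟨a, b, c, d, hA₀, hA₁, hA₂, ?_⟩
  rw [← hE.J_two, hcomm, hA₂]
  simp only [map_add, map_smul, hE.J_zero, hE.J_one, hE.J_three]
  module

end IsAdaptedFrame

/-- `𝔲(2)` acts on the complex line of skew-adjoint antilinear endomorphisms through its trace. -/
theorem IsSkewAntilinear.lie_eq {K A : R4 →L[ℝ] R4} (hy : y ∈ S.domain)
    (hK : S.IsSkewAntilinear y K)
    (hA : ∀ a b, S.metric y (A a) b = -S.metric y a (A b)) (hAJ : ⁅A, S.J y⁆ = 0) :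
    ⁅A, K⁆ = (-(1 / 2) * traceCLM (S.J y * A)) • (S.J y * K) := by
  obtain ⟨_, hu⟩ := exists_ne (0 : R4)
  obtain ⟨E, hE, -⟩ := S.exists_isAdaptedFrame hy hu
  refine hE.skewAntilinear_ext hy (hK.lie hA hAJ) ((hK.J_mul hy).smul _) ?_
  obtain ⟨m, n, hK₀, hK₁, hK₂, hK₃⟩ := hE.exists_skewAntilinear_eq hy hK
  obtain ⟨a, b, c, d, hA₀, hA₁, hA₂, hA₃⟩ := hE.exists_skewLinear_eq hy hA hAJ
  have htr : traceCLM (S.J y * A) = -2 * (a + d) := by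
    rw [hE.isFrame.traceCLM_eq]
    simp [Fin.sum_univ_four, mul_apply_eq_comp, hA₀, hA₁, hA₂, hA₃, hE.J_zero, hE.J_one, hE.J_two,
      hE.J_three, hE.isFrame _ _]
    ring
  simp only [htr, Ring.lie_def, sub_apply, smul_apply, mul_apply_eq_comp, hK₀, hA₀, map_add,
    map_smul, hK₁, hK₂, hK₃, hA₂, hA₃, hE.J_two, hE.J_three]
  module

theorem rhoStar_wedge_nablaJ (hS : S.IsAH1) (hy : y ∈ S.domain) (u v w : R4) :
    S.coord.rhoStar y u v • S.nablaJ y w + S.coord.rhoStar y v w • S.nablaJ y u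
      + S.coord.rhoStar y w u • S.nablaJ y v = 0 := by
  have hlie : ∀ u v w, ⁅curvForm S.lc y u v, S.nablaJ y w⁆ =
      S.J y * (-S.coord.rhoStar y u v • S.nablaJ y w) := fun u v w ↦ by
    rw [(S.isSkewAntilinear_nablaJ hy w).lie_eq hy (S.metric_curvForm_skew hy u v) (hS y hy u v),
      S.rhoStar_eq hy, mul_smul_comm, neg_mul]
  have h := lie_curvForm_covD_cyclic (S.eventually_contDiffAt_lc hy)
    (S.eventually_contDiffAt_J hy) ((S.eventually_mem_domain hy).mono hS) u v w
  have h' := congrArg (S.J y * ·) (hlie u v w ▸ hlie v w u ▸ hlie w u v ▸ h)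
  simp only [← mul_add, ← mul_assoc, S.J_mul_J hy, mul_zero, neg_one_mul] at h'
  linear_combination (norm := module) h'

/-! ### The normal form of the Ricci tensor -/

variable (S) in
/-- The 1-forms `α` at `y` with `ρ ∧ α = 0`; the components of `∇J` are examples. -/
def IsRhoFactor (y : R4) (α : R4 →L[ℝ] ℝ) : Prop :=
  ∀ u v w, S.coord.rho y u v * α w + S.coord.rho y v w * α u + S.coord.rho y w u * α v = 0

theorem isRhoFactor_nablaJ (hS : S.IsAH1) (hy : y ∈ S.domain) (a b : R4) :
    S.IsRhoFactor y (((S.metric y).flip b).comp ((S.nablaJ y).flip a)) := fun u v w ↦ by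
  have h := congrArg (fun K : R4 →L[ℝ] R4 ↦ S.metric y (K a) b) (S.rhoStar_wedge_nablaJ hS hy u v w)
  simpa [S.rhoStar_eq_rho hS hy] using h

theorem IsFrame.map_sharp (hE : S.IsFrame y E) (T : R4 →ₗ[ℝ] ℝ) (α : R4 →L[ℝ] ℝ) :
    T (S.coord.sharp y α) = ∑ k, T (E k) * α (E k) := by
  rw [hE.sharp_eq, map_sum]
  simp only [map_smul, smul_eq_mul, mul_comm]

namespace IsRhoFactor

variable {α : R4 →L[ℝ] ℝ}

theorem ricci_self_mul (hα : S.IsRhoFactor y α) (hS : S.IsAH1) (hy : y ∈ S.domain) (u w : R4) :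
    S.coord.ricci y u u * α w =
      S.coord.ricci y u w * α u + S.coord.ricci y (S.J y u) w * α (S.J y u) := by
  have h := hα u (S.J y u) w
  have hJw : S.coord.ricci y (S.J y w) u = -S.coord.ricci y (S.J y u) w := by
    rw [S.ricci_J_left hS hy, S.ricci_symm hy w]
  rw [S.rho_eq hS hy, S.rho_eq hS hy, S.rho_eq hS hy, S.ricci_J_J hS hy, S.ricci_J_left hS hy _ w,
    S.ricci_J_J hS hy, hJw] at h
  linarith

theorem scal_mul (hα : S.IsRhoFactor y α) (hS : S.IsAH1) (hy : y ∈ S.domain) (w : R4) :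
    S.coord.scal y * α w = 2 * S.coord.ricci y (S.coord.sharp y α) w := by
  obtain ⟨E, hE⟩ := S.exists_isFrame hy
  have hsharp {F : Fin 4 → R4} (hF : S.IsFrame y F) :
      S.coord.ricci y (S.coord.sharp y α) w = ∑ k, S.coord.ricci y (F k) w * α (F k) :=
    hF.map_sharp ((S.isBilinearMap_ricci hy).toLinearMap.flip w) α
  rw [scal, hE.tr_eq (S.isBilinearMap_ricci hy), Finset.sum_mul,
    Finset.sum_congr rfl fun k _ ↦ hα.ricci_self_mul hS hy (E k) w, Finset.sum_add_distrib,
    ← hsharp hE, ← hsharp (hE.J_comp hy), two_mul]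

theorem exists_ricci_eq (hα : S.IsRhoFactor y α) (hS : S.IsAH1) (hy : y ∈ S.domain)
    (hα0 : α ≠ 0) : ∃ E, S.IsAdaptedFrame y E ∧ ∀ u v, S.coord.ricci y u v =
      S.coord.scal y / 2 *
        (S.metric y u (E 0) * S.metric y v (E 0) + S.metric y u (E 1) * S.metric y v (E 1)) := by
  have hsharp : S.coord.sharp y α ≠ 0 := fun h ↦
    hα0 (ContinuousLinearMap.ext fun w ↦ by rw [← S.metric_sharp hy, h, map_zero, zero_apply])
  obtain ⟨E, hE, r, hr, hE0⟩ := S.exists_isAdaptedFrame hy hsharp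
  have hB := S.isBilinearMap_ricci hy
  have hα_eq : ∀ w, α w = r⁻¹ * S.metric y (E 0) w := fun w ↦ by
    simp [hE0, S.metric_sharp hy, hr]
  have h₀ : ∀ w, S.coord.ricci y (E 0) w = S.coord.scal y / 2 * S.metric y w (E 0) := fun w ↦ by
    have h := hα.scal_mul hS hy w
    rw [S.symm y hy w, hE0, hB.smul_left, map_smul, smul_apply, S.metric_sharp hy, smul_eq_mul,
      smul_eq_mul]
    linear_combination -(r / 2) * h
  have h₁ : ∀ w, S.coord.ricci y (E 1) w = S.coord.scal y / 2 * S.metric y w (E 1) := fun w ↦ by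
    rw [← hE.J_zero, S.ricci_J_left hS hy, h₀, S.metric_J_left hy]
    ring
  have h₂₂ : S.coord.ricci y (E 2) (E 2) = 0 := by
    have h := hα.ricci_self_mul hS hy (E 2) (E 0)
    simpa [hα_eq, hE.J_two, hE.isFrame _ _, hr] using h
  have h₂₃ : S.coord.ricci y (E 2) (E 3) = 0 := by
    have h := S.ricci_J_left hS hy (E 2) (E 2)
    rw [hE.J_two, S.ricci_symm hy (E 3)] at h
    linarith
  have h₂ : ∀ w, S.coord.ricci y (E 2) w = 0 := fun w ↦ by
    rw [← hE.isFrame.sum_metric_smul w]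
    simp only [Fin.sum_univ_four, hB.add_right, hB.smul_right, S.ricci_symm hy (E 2) (E 0),
      S.ricci_symm hy (E 2) (E 1), h₀, h₁, h₂₂, h₂₃, hE.isFrame _ _]
    simp
  have h₃ : ∀ w, S.coord.ricci y (E 3) w = 0 := fun w ↦ by
    rw [← hE.J_two, S.ricci_J_left hS hy, h₂, neg_zero]
  refine ⟨E, hE, fun u v ↦ ?_⟩
  conv_lhs => rw [← hE.isFrame.sum_metric_smul u]
  simp only [Fin.sum_univ_four, hB.add_left, hB.smul_left, h₀, h₁, h₂, h₃, smul_eq_mul]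
  ring

end IsRhoFactor

variable (S) in
/-- Adapted frames in which the Ricci tensor is a multiple of the metric of the plane of `E 0` and
`E 1`, and in which `∇J`, a 1-form with values in the complex line of skew-adjoint antilinear
endomorphisms, involves only the covectors dual to `E 0` and `E 1`. The numbers `m₀, n₀` and
`m₁, n₁` are the coordinates of `(∇_{E 0} J) E 0` and `(∇_{E 1} J) E 0` along `E 2` and `E 3`. -/
structure IsRicciFrame (y : R4) (E : Fin 4 → R4) (m₀ n₀ m₁ n₁ : ℝ) : Prop
    extends S.IsAdaptedFrame y E where
  ricci_eq : ∀ u v, S.coord.ricci y u v = S.coord.scal y / 2 *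
    (S.metric y u (E 0) * S.metric y v (E 0) + S.metric y u (E 1) * S.metric y v (E 1))
  nablaJ_eq : ∀ u v, S.nablaJ y u v =
    (S.metric y u (E 0) * m₀ + S.metric y u (E 1) * m₁) •
        (S.metric y v (E 0) • E 2 - S.metric y v (E 1) • E 3
          - S.metric y v (E 2) • E 0 + S.metric y v (E 3) • E 1)
      + (S.metric y u (E 0) * n₀ + S.metric y u (E 1) * n₁) •
        (S.metric y v (E 0) • E 3 + S.metric y v (E 1) • E 2
          - S.metric y v (E 2) • E 1 - S.metric y v (E 3) • E 0)

theorem exists_isRhoFactor_ne_zero (hS : S.IsAH1) (hy : y ∈ S.domain) (hJ : S.nablaJ y ≠ 0) :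
    ∃ α, S.IsRhoFactor y α ∧ α ≠ 0 := by
  by_contra! h
  refine hJ (ContinuousLinearMap.ext fun w ↦ ContinuousLinearMap.ext fun a ↦ ?_)
  exact S.eq_of_metric_eq hy fun b ↦ by
    simpa using DFunLike.congr_fun (h _ (S.isRhoFactor_nablaJ hS hy a b)) w

theorem exists_isRicciFrame (hS : S.IsAH1) (hy : y ∈ S.domain) (hs : S.coord.scal y ≠ 0)
    (hJ : S.nablaJ y ≠ 0) : ∃ E m₀ n₀ m₁ n₁, S.IsRicciFrame y E m₀ n₀ m₁ n₁ := by
  obtain ⟨α, hα, hα0⟩ := S.exists_isRhoFactor_ne_zero hS hy hJ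
  obtain ⟨E, hE, hric⟩ := hα.exists_ricci_eq hS hy hα0
  have hzero : ∀ w, (∀ u, S.coord.ricci y u w = 0) → S.nablaJ y w = 0 := fun w hw ↦ by
    ext1 a
    refine S.eq_of_metric_eq hy fun b ↦ ?_
    have h := (S.isRhoFactor_nablaJ hS hy a b).scal_mul hS hy w
    simpa [hw, hs] using h
  have h₂ : S.nablaJ y (E 2) = 0 := hzero _ fun u ↦ by simp [hric, hE.isFrame _ _]
  have h₃ : S.nablaJ y (E 3) = 0 := hzero _ fun u ↦ by simp [hric, hE.isFrame _ _]
  obtain ⟨m₀, n₀, h₀₀, h₀₁, h₀₂, h₀₃⟩ :=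
    hE.exists_skewAntilinear_eq hy (S.isSkewAntilinear_nablaJ hy (E 0))
  obtain ⟨m₁, n₁, h₁₀, h₁₁, h₁₂, h₁₃⟩ :=
    hE.exists_skewAntilinear_eq hy (S.isSkewAntilinear_nablaJ hy (E 1))
  refine ⟨E, m₀, n₀, m₁, n₁, hE, hric, fun u v ↦ ?_⟩
  conv_lhs => rw [← hE.isFrame.sum_metric_smul u, ← hE.isFrame.sum_metric_smul v]
  simp only [Fin.sum_univ_four, map_add, map_smul, add_apply, smul_apply, h₀₀, h₀₁, h₀₂, h₀₃, h₁₀,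
    h₁₁, h₁₂, h₁₃, h₂, h₃, zero_apply]
  module

theorem ricci_eq_zero_of_scal_eq_zero (hS : S.IsAH1) (hy : y ∈ S.domain)
    (hs : S.coord.scal y = 0) (hJ : S.nablaJ y ≠ 0) : S.coord.ricci y = 0 := by
  obtain ⟨α, hα, hα0⟩ := S.exists_isRhoFactor_ne_zero hS hy hJ
  obtain ⟨E, -, hric⟩ := hα.exists_ricci_eq hS hy hα0
  funext u v
  simp [hric, hs]

theorem nablaJ_eq_zero_or_ricci_eq_zero_or_exists_isRicciFrame (hS : S.IsAH1)
    (hy : y ∈ S.domain) : S.nablaJ y = 0 ∨ S.coord.ricci y = 0 ∨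
      S.coord.scal y ≠ 0 ∧ ∃ E m₀ n₀ m₁ n₁, S.IsRicciFrame y E m₀ n₀ m₁ n₁ := by
  by_cases hJ : S.nablaJ y = 0
  · exact .inl hJ
  by_cases hs : S.coord.scal y = 0
  · exact .inr (.inl (S.ricci_eq_zero_of_scal_eq_zero hS hy hs hJ))
  · exact .inr (.inr ⟨hs, S.exists_isRicciFrame hS hy hs hJ⟩)

variable (S) in
/-- The Lee form at `y` as a continuous linear form. -/
def leeCLM (y : R4) : R4 →L[ℝ] ℝ :=
  -traceCLM.comp ((S.nablaJ y).flip.comp (S.J y))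

theorem lee_eq_leeCLM (hy : y ∈ S.domain) : S.coord.lee y = S.leeCLM y :=
  funext fun v ↦ S.lee_eq hy v

theorem isBilinearMap_nij (hy : y ∈ S.domain) : IsBilinearMap ℝ (S.coord.nij y) := by
  constructor <;> intros <;> simp only [S.nij_eq hy, map_add, map_smul, add_apply, smul_apply] <;>
    module

theorem IsFrame.nijNormSq_eq (hy : y ∈ S.domain) (hE : S.IsFrame y E) :
    S.coord.nijNormSq y = (1 / 2) * ∑ k, ∑ l,
      S.metric y (S.coord.nij y (E k) (E l)) (S.coord.nij y (E k) (E l)) := by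
  have hN := S.isBilinearMap_nij hy
  have h : ∀ u u', S.coord.tr y (fun v v' ↦ S.coord.g y (S.coord.nij y u v) (S.coord.nij y u' v'))
      = ∑ l, S.metric y (S.coord.nij y u (E l)) (S.coord.nij y u' (E l)) :=
    fun u u' ↦ hE.tr_eq (by constructor <;> intros <;> simp [hN.add_right, hN.smul_right])
  simp only [nijNormSq, h]
  rw [hE.tr_eq]
  constructor <;> intros <;>
    simp [hN.add_left, hN.smul_left, Finset.sum_add_distrib, Finset.mul_sum]

namespace IsRicciFrame

variable {m₀ n₀ m₁ n₁ : ℝ} (hE : S.IsRicciFrame y E m₀ n₀ m₁ n₁)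

include hE

theorem lee_apply (hy : y ∈ S.domain) (v : R4) : S.coord.lee y v =
    (n₀ - m₁) * S.metric y v (E 2) - (m₀ + n₁) * S.metric y v (E 3) := by
  rw [S.lee_eq hy, hE.isFrame.traceCLM_eq, hE.J_apply v]
  simp [Fin.sum_univ_four, hE.nablaJ_eq, hE.isFrame _ _]
  ring

theorem inner1_lee (hy : y ∈ S.domain) : S.coord.inner1 y (S.coord.lee y) (S.coord.lee y) =
    (n₀ - m₁) ^ 2 + (m₀ + n₁) ^ 2 := by
  have h : S.leeCLM y = S.coord.lee y := (S.lee_eq_leeCLM hy).symm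
  rw [← h, hE.isFrame.inner1_eq, h]
  simp only [hE.lee_apply hy, hE.isFrame _ _, mul_ite, mul_one, mul_zero, Fin.sum_univ_four,
    Fin.reduceEq, ↓reduceIte, sub_self, add_zero, sub_zero, zero_add, zero_sub, neg_add_rev]
  ring

theorem nij_apply (hy : y ∈ S.domain) (u v : R4) : S.coord.nij y u v =
    (S.metric y u (E 0) * S.metric y v (E 2) - S.metric y u (E 2) * S.metric y v (E 0)
      - S.metric y u (E 1) * S.metric y v (E 3) + S.metric y u (E 3) * S.metric y v (E 1)) •
      (-(m₁ + n₀) • E 0 + (m₀ - n₁) • E 1)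
    + (S.metric y u (E 1) * S.metric y v (E 2) - S.metric y u (E 2) * S.metric y v (E 1)
      + S.metric y u (E 0) * S.metric y v (E 3) - S.metric y u (E 3) * S.metric y v (E 0)) •
      ((m₀ - n₁) • E 0 + (m₁ + n₀) • E 1) := by
  simp only [S.nij_eq hy, hE.J_apply, hE.nablaJ_eq]
  simp [hE.isFrame _ _]
  module

theorem nijNormSq_eq (hy : y ∈ S.domain) :
    S.coord.nijNormSq y = 4 * ((m₁ + n₀) ^ 2 + (m₀ - n₁) ^ 2) := by
  rw [hE.isFrame.nijNormSq_eq hy]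
  simp [Fin.sum_univ_four, hE.nij_apply hy, hE.isFrame _ _]
  ring

theorem Phi_apply (hy : y ∈ S.domain) (u v : R4) : S.coord.Phi y u v = (m₀ * n₁ - m₁ * n₀) *
    (S.metric y u (E 0) * S.metric y v (E 1) - S.metric y u (E 1) * S.metric y v (E 0)) := by
  rw [S.Phi_eq hy, hE.isFrame.traceCLM_eq]
  simp [Fin.sum_univ_four, mul_apply_eq_comp, hE.nablaJ_eq, hE.isFrame _ _, hE.J_zero,
    hE.J_one, hE.J_two, hE.J_three]
  ring

theorem delta1_lee (hS : S.IsAH1) (hy : y ∈ S.domain) :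
    S.coord.delta1 y S.coord.lee = -2 * (m₀ * n₁ - m₁ * n₀) := by
  rw [S.delta1_lee hS hy hE.isFrame]
  simp [Fin.sum_univ_four, Ring.lie_def, mul_apply_eq_comp, hE.nablaJ_eq, hE.isFrame _ _]
  ring

theorem rho_apply (hS : S.IsAH1) (hy : y ∈ S.domain) (u v : R4) :
    S.coord.rho y u v = S.coord.scal y / 2 *
      (S.metric y u (E 0) * S.metric y v (E 1) - S.metric y u (E 1) * S.metric y v (E 0)) := by
  have h₀ : S.metric y (S.J y u) (E 0) = -S.metric y u (E 1) := by
    rw [S.metric_J_left hy, hE.J_zero]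
  have h₁ : S.metric y (S.J y u) (E 1) = S.metric y u (E 0) := by
    rw [S.metric_J_left hy, hE.J_one, map_neg, neg_neg]
  rw [S.rho_eq hS hy, hE.ricci_eq, h₀, h₁]
  ring

theorem imN_le (hy : y ∈ S.domain) : S.coord.imN y ≤ Submodule.span ℝ {E 0, E 1} := by
  rw [imN, Submodule.span_le]
  rintro _ ⟨u, v, rfl⟩
  rw [SetLike.mem_coe, hE.nij_apply hy]
  exact add_mem (Submodule.smul_mem _ _ (Submodule.mem_span_pair.2 ⟨_, _, rfl⟩))
    (Submodule.smul_mem _ _ (Submodule.mem_span_pair.2 ⟨_, _, rfl⟩))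

theorem imN_eq (hy : y ∈ S.domain) (hN : S.coord.nij y ≠ 0) :
    S.coord.imN y = Submodule.span ℝ {E 0, E 1} := by
  set a := m₀ - n₁ with ha
  set b := m₁ + n₀ with hb
  have hab : a ^ 2 + b ^ 2 ≠ 0 := fun h ↦ hN <| by
    have ha0 : a = 0 := by nlinarith
    have hb0 : b = 0 := by nlinarith
    funext u v
    simp [hE.nij_apply hy, ← ha, ← hb, ha0, hb0]
  have hnij : ∀ r t : ℝ, S.coord.nij y (E 0) (r • E 2 + t • E 3) =
      (t * a - r * b) • E 0 + (r * a + t * b) • E 1 := fun r t ↦ by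
    simp only [hE.nij_apply hy, hE.isFrame _ _, ↓reduceIte, map_add, map_smul, add_apply,
      smul_apply, smul_eq_mul, mul_one, Fin.reduceEq, mul_zero, add_zero, one_mul, sub_zero,
      zero_ne_one, zero_add, zero_mul, ← hb, ← ha]
    module
  refine le_antisymm (hE.imN_le hy) (Submodule.span_le.2 ?_)
  rintro _ (rfl | rfl)
  · refine Submodule.subset_span
      ⟨E 0, (-b / (a ^ 2 + b ^ 2)) • E 2 + (a / (a ^ 2 + b ^ 2)) • E 3, ?_⟩
    rw [hnij]
    match_scalars <;> field_simp <;> ring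
  · refine Submodule.subset_span
      ⟨E 0, (a / (a ^ 2 + b ^ 2)) • E 2 + (b / (a ^ 2 + b ^ 2)) • E 3, ?_⟩
    rw [hnij]
    match_scalars <;> field_simp
    ring

theorem ricci_of_mem_imN (hy : y ∈ S.domain) {X : R4} (hX : X ∈ S.coord.imN y) (v : R4) :
    S.coord.ricci y X v = S.coord.scal y / 2 * S.metric y X v := by
  obtain ⟨a, b, rfl⟩ := Submodule.mem_span_pair.1 (hE.imN_le hy hX)
  rw [hE.ricci_eq]
  simp [hE.isFrame _ _, S.symm y hy v]

theorem ricci_sharp_lee (hy : y ∈ S.domain) (v : R4) :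
    S.coord.ricci y (S.coord.sharp y (S.coord.lee y)) v = 0 := by
  have h : ∀ w, S.metric y (S.coord.sharp y (S.coord.lee y)) w = S.coord.lee y w := fun w ↦ by
    rw [S.lee_eq_leeCLM hy, S.metric_sharp hy]
  simp [hE.ricci_eq, h, hE.lee_apply hy, hE.isFrame _ _]

end IsRicciFrame

theorem IsFrame.proj_span_pair (hE : S.IsFrame y E) (u : R4) :
    S.coord.proj y (Submodule.span ℝ {E 0, E 1}) u =
      S.metric y u (E 0) • E 0 + S.metric y u (E 1) • E 1 := by
  have hex : ∃ a, a ∈ Submodule.span ℝ {E 0, E 1} ∧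
      ∀ w ∈ Submodule.span ℝ {E 0, E 1}, S.coord.g y (u - a) w = 0 := by
    refine ⟨_, Submodule.mem_span_pair.2 ⟨S.metric y u (E 0), S.metric y u (E 1), rfl⟩, ?_⟩
    intro w hw
    obtain ⟨a, b, rfl⟩ := Submodule.mem_span_pair.1 hw
    simp only [coord_g, map_sub, map_add, map_smul, sub_apply, smul_eq_mul, add_apply, smul_apply,
      hE _ _, ↓reduceIte, mul_one, zero_ne_one, mul_zero, add_zero, one_ne_zero, zero_add]
    ring
  obtain ⟨hmem, horth⟩ := Classical.epsilon_spec hex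
  obtain ⟨a, b, hab⟩ := Submodule.mem_span_pair.1 hmem
  rw [← hab] at horth
  have h₀ : S.metric y u (E 0) = a := by
    simpa [hE _ _, sub_eq_zero] using horth (E 0) (Submodule.subset_span (by simp))
  have h₁ : S.metric y u (E 1) = b := by
    simpa [hE _ _, sub_eq_zero] using horth (E 1) (Submodule.subset_span (by simp))
  rw [proj, ← hab, h₀, h₁]

theorem IsAdaptedFrame.omegaOn_span_pair (hE : S.IsAdaptedFrame y E) (u v : R4) :
    S.coord.omegaOn y (Submodule.span ℝ {E 0, E 1}) u v =
      S.metric y u (E 0) * S.metric y v (E 1) - S.metric y u (E 1) * S.metric y v (E 0) := by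
  rw [omegaOn, hE.isFrame.proj_span_pair, hE.isFrame.proj_span_pair]
  simp only [omega, coord_J, map_add, map_smul, hE.J_zero, hE.J_one, smul_neg, coord_g, map_neg,
    add_apply, smul_apply, hE.isFrame _ _, one_ne_zero, ↓reduceIte, smul_eq_mul, mul_zero, mul_one,
    zero_add, neg_apply, zero_ne_one]
  ring

/-! ### Pointwise consequences -/

theorem lee_eq_zero_of_nablaJ_eq_zero (hy : y ∈ S.domain) (hJ : S.nablaJ y = 0) :
    S.coord.lee y = 0 :=
  funext fun v ↦ by simp [S.lee_eq hy, hJ]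

theorem nij_eq_zero_of_nablaJ_eq_zero (hy : y ∈ S.domain) (hJ : S.nablaJ y = 0) :
    S.coord.nij y = 0 :=
  funext₂ fun u v ↦ by simp [S.nij_eq hy, hJ]

theorem Phi_eq_zero_of_nablaJ_eq_zero (hy : y ∈ S.domain) (hJ : S.nablaJ y = 0) :
    S.coord.Phi y = 0 :=
  funext₂ fun u v ↦ by simp [S.Phi_eq hy, hJ]

theorem rho_eq_zero_of_ricci_eq_zero (hric : S.coord.ricci y = 0) : S.coord.rho y = 0 :=
  funext₂ fun u v ↦ by simp [rho, hric]

theorem scal_eq_zero_of_ricci_eq_zero (hric : S.coord.ricci y = 0) : S.coord.scal y = 0 := by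
  simp [scal, tr, hric]

theorem sharp_metric (hy : y ∈ S.domain) (u : R4) : S.coord.sharp y (S.metric y u) = u :=
  S.eq_of_metric_eq hy (S.metric_sharp hy _)

theorem Jform_eq_neg_comp (α : R4 →L[ℝ] ℝ) : S.coord.Jform y α = ⇑(-α.comp (S.J y)) :=
  rfl

theorem sharp_Jform (hy : y ∈ S.domain) (α : R4 →L[ℝ] ℝ) :
    S.coord.sharp y (S.coord.Jform y α) = S.J y (S.coord.sharp y α) := by
  refine S.eq_of_metric_eq hy fun w ↦ ?_
  rw [S.Jform_eq_neg_comp, S.metric_sharp hy, S.metric_J_left hy, S.metric_sharp hy]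
  rfl

theorem ricci_sharp_lee (hS : S.IsAH1) (hy : y ∈ S.domain) (v : R4) :
    S.coord.ricci y (S.coord.sharp y (S.coord.lee y)) v = 0 := by
  obtain hJ | hric | ⟨-, E, m₀, n₀, m₁, n₁, hE⟩ :=
    S.nablaJ_eq_zero_or_ricci_eq_zero_or_exists_isRicciFrame hS hy
  · have h : S.coord.sharp y (S.coord.lee y) = 0 := by
      simp [sharp, S.lee_eq_zero_of_nablaJ_eq_zero hy hJ]
    rw [h]
    exact (S.isBilinearMap_ricci hy).toLinearMap.map_zero₂ v
  · rw [hric, Pi.zero_apply, Pi.zero_apply]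
  · exact hE.ricci_sharp_lee hy v

theorem ricci_sharp_Jform_lee (hS : S.IsAH1) (hy : y ∈ S.domain) (v : R4) :
    S.coord.ricci y (S.coord.sharp y (S.coord.Jform y (S.coord.lee y))) v = 0 := by
  rw [S.lee_eq_leeCLM hy, S.sharp_Jform hy, S.ricci_J_left hS hy, ← S.lee_eq_leeCLM hy,
    S.ricci_sharp_lee hS hy, neg_zero]

theorem ricci0Form_eq_of_ricci_sharp_eq_zero (hy : y ∈ S.domain) {α : R4 →L[ℝ] ℝ}
    (hα : ∀ v, S.coord.ricci y (S.coord.sharp y α) v = 0) :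
    S.coord.ricci0Form y α = (-(S.coord.scal y / 4)) • ⇑α := by
  funext v
  simp [ricci0Form, ricci0, hα, S.metric_sharp hy]

theorem ricci0Form_lee (hS : S.IsAH1) (hy : y ∈ S.domain) :
    S.coord.ricci0Form y (S.coord.lee y) = (-(S.coord.scal y / 4)) • S.coord.lee y := by
  have h := S.ricci_sharp_lee hS hy
  rw [S.lee_eq_leeCLM hy] at h ⊢
  exact S.ricci0Form_eq_of_ricci_sharp_eq_zero hy h

theorem ricci0Form_Jform_lee (hS : S.IsAH1) (hy : y ∈ S.domain) :
    S.coord.ricci0Form y (S.coord.Jform y (S.coord.lee y)) =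
      (-(S.coord.scal y / 4)) • S.coord.Jform y (S.coord.lee y) := by
  have h := S.ricci_sharp_Jform_lee hS hy
  rw [S.lee_eq_leeCLM hy, S.Jform_eq_neg_comp] at h ⊢
  exact S.ricci0Form_eq_of_ricci_sharp_eq_zero hy h

theorem ricci_of_mem_imN (hS : S.IsAH1) (hy : y ∈ S.domain) {X : R4} (hX : X ∈ S.coord.imN y)
    (v : R4) : S.coord.ricci y X v = S.coord.scal y / 2 * S.metric y X v := by
  obtain hJ | hric | ⟨-, E, m₀, n₀, m₁, n₁, hE⟩ :=
    S.nablaJ_eq_zero_or_ricci_eq_zero_or_exists_isRicciFrame hS hy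
  · have hX0 : X = 0 := by
      have hX' : X ∈ Submodule.span ℝ ({0} : Set R4) := by
        simpa [imN, S.nij_eq_zero_of_nablaJ_eq_zero hy hJ] using hX
      simpa using hX'
    rw [hX0, map_zero, zero_apply, mul_zero]
    exact (S.isBilinearMap_ricci hy).toLinearMap.map_zero₂ v
  · simp [hric, S.scal_eq_zero_of_ricci_eq_zero hric]
  · exact hE.ricci_of_mem_imN hy hX v

theorem ricci0Vec_of_mem_imN (hS : S.IsAH1) (hy : y ∈ S.domain) {X : R4}
    (hX : X ∈ S.coord.imN y) : S.coord.ricci0Vec y X = (S.coord.scal y / 4) • X := by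
  have h : S.coord.ricci0 y X = S.metric y ((S.coord.scal y / 4) • X) := by
    funext v
    simp only [ricci0, S.ricci_of_mem_imN hS hy hX, coord_g, map_smul, smul_apply, smul_eq_mul]
    ring
  rw [ricci0Vec, h, S.sharp_metric hy]

theorem metric_eq_zero_of_mem_span_lee_of_mem_imN (hS : S.IsAH1) (hy : y ∈ S.domain)
    (hs : S.coord.scal y ≠ 0) {X Y : R4}
    (hX : X ∈ Submodule.span ℝ {S.coord.sharp y (S.coord.lee y),
      S.coord.sharp y (S.coord.Jform y (S.coord.lee y))})
    (hY : Y ∈ S.coord.imN y) : S.metric y X Y = 0 := by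
  obtain ⟨a, b, rfl⟩ := Submodule.mem_span_pair.1 hX
  have hB := S.isBilinearMap_ricci hy
  have h := S.ricci_of_mem_imN hS hy hY (a • S.coord.sharp y (S.coord.lee y)
    + b • S.coord.sharp y (S.coord.Jform y (S.coord.lee y)))
  rw [S.ricci_symm hy, S.symm y hy Y, hB.add_left, hB.smul_left, hB.smul_left,
    S.ricci_sharp_lee hS hy, S.ricci_sharp_Jform_lee hS hy, smul_zero, smul_zero, add_zero,
    zero_eq_mul] at h
  exact h.resolve_left (div_ne_zero hs two_ne_zero)

theorem ricci_eq_zero_or_lee_eq_zero_and_nij_eq_zero (hS : S.IsAH1) (hy : y ∈ S.domain)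
    (hs : S.coord.scal y = 0) :
    S.coord.ricci y = 0 ∨ (S.coord.lee y = 0 ∧ S.coord.nij y = 0) := by
  obtain hJ | hric | ⟨hs', -⟩ := S.nablaJ_eq_zero_or_ricci_eq_zero_or_exists_isRicciFrame hS hy
  · exact .inr ⟨S.lee_eq_zero_of_nablaJ_eq_zero hy hJ, S.nij_eq_zero_of_nablaJ_eq_zero hy hJ⟩
  · exact .inl hric
  · exact absurd hs hs'

theorem exists_smul_rho_add_smul_Phi_eq_zero (hS : S.IsAH1) (hy : y ∈ S.domain) :
    ∃ a b : ℝ, (a ≠ 0 ∨ b ≠ 0) ∧ a • S.coord.rho y + b • S.coord.Phi y = 0 := by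
  obtain hJ | hric | ⟨hs, E, m₀, n₀, m₁, n₁, hE⟩ :=
    S.nablaJ_eq_zero_or_ricci_eq_zero_or_exists_isRicciFrame hS hy
  · exact ⟨0, 1, .inr one_ne_zero, by simp [S.Phi_eq_zero_of_nablaJ_eq_zero hy hJ]⟩
  · exact ⟨1, 0, .inl one_ne_zero, by simp [rho_eq_zero_of_ricci_eq_zero hric]⟩
  · refine ⟨m₀ * n₁ - m₁ * n₀, -(S.coord.scal y / 2), .inr (by simpa using hs), ?_⟩
    funext u v
    simp only [Pi.add_apply, Pi.smul_apply, hE.rho_apply hS hy, hE.Phi_apply hy, smul_eq_mul,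
      Pi.zero_apply]
    ring

theorem wedge_rhoStar_Phi (hS : S.IsAH1) (hy : y ∈ S.domain) (u v w z : R4) :
    wedge (S.coord.rhoStar y) (S.coord.Phi y) u v w z = 0 := by
  obtain hJ | hric | ⟨-, E, m₀, n₀, m₁, n₁, hE⟩ :=
    S.nablaJ_eq_zero_or_ricci_eq_zero_or_exists_isRicciFrame hS hy
  · simp [wedge, S.Phi_eq_zero_of_nablaJ_eq_zero hy hJ]
  · simp [wedge, S.rhoStar_eq_rho hS hy, rho_eq_zero_of_ricci_eq_zero hric]
  · simp only [wedge, S.rhoStar_eq_rho hS hy, hE.rho_apply hS hy, hE.Phi_apply hy]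
    ring

theorem rho_Phi_eq_smul_omegaOn_imN (hS : S.IsAH1) (hy : y ∈ S.domain)
    (hs : S.coord.scal y ≠ 0) (hN : S.coord.nij y ≠ 0) :
    S.coord.rho y = (S.coord.scal y / 2) • S.coord.omegaOn y (S.coord.imN y) ∧
      S.coord.Phi y = ((1 / 4) * (S.coord.inner1 y (S.coord.lee y) (S.coord.lee y)
        - (1 / 4) * S.coord.nijNormSq y)) • S.coord.omegaOn y (S.coord.imN y) ∧
      S.coord.Phi y = (-(1 / 2) * S.coord.delta1 y S.coord.lee) •
        S.coord.omegaOn y (S.coord.imN y) := by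
  have hJ : S.nablaJ y ≠ 0 := fun hJ ↦ hN (S.nij_eq_zero_of_nablaJ_eq_zero hy hJ)
  obtain ⟨E, m₀, n₀, m₁, n₁, hE⟩ := S.exists_isRicciFrame hS hy hs hJ
  rw [hE.inner1_lee hy, hE.nijNormSq_eq hy, hE.delta1_lee hS hy, hE.imN_eq hy hN]
  refine ⟨?_, ?_, ?_⟩ <;> funext u v <;>
    simp only [Pi.smul_apply, smul_eq_mul, hE.rho_apply hS hy, hE.Phi_apply hy,
      hE.omegaOn_span_pair] <;>
    ring

end LocalAlmostHermitian

end

theorem proposition5p2 {M : Type*} [TopologicalSpace M] [ChartedSpace R4 M]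
    [IsManifold (𝓡 4) ∞ M] (A : AlmostHermitian M) (hA : A.IsAH1)
    (e : OpenPartialHomeomorph M R4) (he : e ∈ IsManifold.maximalAtlas (𝓡 4) ∞ M)
    (c : Coord) (hc : c = A.inChart e) (x : R4) (hx : x ∈ e.target) :
    -- `θ` and `Jθ` are eigenforms of `Ric₀`
    (c.ricci0Form x (c.lee x) = (-(c.scal x / 4)) • c.lee x ∧
      c.ricci0Form x (c.Jform x (c.lee x)) = (-(c.scal x / 4)) • c.Jform x (c.lee x)) ∧
    -- orthogonality of `Span(θ, Jθ)` and `Im N` where `s ≠ 0`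
    (c.scal x ≠ 0 →
      ∀ X ∈ Submodule.span ℝ {c.sharp x (c.lee x), c.sharp x (c.Jform x (c.lee x))},
        ∀ Y ∈ c.imN x, c.g x X Y = 0) ∧
    -- `Ric₀` on `Im N`
    (∀ X ∈ c.imN x, c.ricci0Vec x X = (c.scal x / 4) • X) ∧
    -- points where `s = 0`
    (c.scal x = 0 → c.ricci x = 0 ∨ (c.lee x = 0 ∧ c.nij x = 0)) ∧
    -- `ρ` and `Φ` are closed, pointwise collinear, and explicit at generic points
    ((∀ u v w, Coord.extd c.rho x u v w = 0) ∧ (∀ u v w, Coord.extd c.Phi x u v w = 0) ∧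
      (∃ a b : ℝ, (a ≠ 0 ∨ b ≠ 0) ∧ a • c.rho x + b • c.Phi x = 0) ∧
      (c.scal x ≠ 0 → c.lee x ≠ 0 → c.nij x ≠ 0 →
        c.rho x = (c.scal x / 2) • c.omegaOn x (c.imN x) ∧
        c.Phi x = ((1 / 4) * (c.inner1 x (c.lee x) (c.lee x) - (1 / 4) * c.nijNormSq x)) •
          c.omegaOn x (c.imN x) ∧
        c.Phi x = (-(1 / 2) * c.delta1 x c.lee) • c.omegaOn x (c.imN x))) ∧
    -- `ρ* ∧ Φ = 0`
    (∀ u v w z, Coord.wedge (c.rhoStar x) (c.Phi x) u v w z = 0) := by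
  subst hc
  have hS : (A.toLocal he).IsAH1 := LocalAlmostHermitian.isAH1_of_curv_eq (hA e he)
  exact ⟨⟨(A.toLocal he).ricci0Form_lee hS hx, (A.toLocal he).ricci0Form_Jform_lee hS hx⟩,
    fun hs X hX Y hY ↦
      (A.toLocal he).metric_eq_zero_of_mem_span_lee_of_mem_imN hS hx hs hX hY,
    fun X hX ↦ (A.toLocal he).ricci0Vec_of_mem_imN hS hx hX,
    (A.toLocal he).ricci_eq_zero_or_lee_eq_zero_and_nij_eq_zero hS hx,
    ⟨(A.toLocal he).extd_rho hS hx, (A.toLocal he).extd_Phi hS hx,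
      (A.toLocal he).exists_smul_rho_add_smul_Phi_eq_zero hS hx,
      fun hs _ hN ↦ (A.toLocal he).rho_Phi_eq_smul_omegaOn_imN hS hx hs hN⟩,
    (A.toLocal he).wedge_rhoStar_Phi hS hx⟩
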